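/- Let $N$ be a smooth manifold of dimension $n$ (Hausdorff, second countable, without boundary), let $\rho=\langle\cdot,\cdot\rangle$ be a $C^2$ Riemannian metric on $N$, and let $0\le k<n$. Let $g:\mathbb R^k\to\mathbb R$ be a $C^2$ nonnegative function that vanishes exactly at the origin, and let $F=(F_1,\dots,F_k):N\to\mathbb R^k$ be a $C^3$ map for which $0$ is a regular value. Assume that $\langle\nabla F_i,\nabla F_j\rangle\equiv 0$ on $N$ for $i\ne j$, and that the vector fields $\nabla F_i/\|\nabla F_i\|^2$ pairwise commute wherever both are defined (gradients and norms with respect to $\rho$). Put $U=g\circ F$ and $M=U^{-1}(0)=F^{-1}(0)$. For a one-form $\mu$ on $N$ consider the Lagrangian $$L_\mu(x,v)=\tfrac12\|v\|_x^2+\mu_x(v)-U(x),\qquad (x,v)\in TN.$$ 1. For every $C^2$ one-form $\omega$ on $\mathbb R^k$, with magnetic potential $\mu=F^*\omega$, every point $(p,0)$ with $p\in M$ is a Lyapunov unstable equilibrium point of the Euler–Lagrange dynamics of $L_\mu$. That is, the constant curve $p$ is a solution, and there is a neighborhood $V$ of $(p,0)$ in $TN$ such that every neighborhood of $(p,0)$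 contains the initial condition $(\gamma(0),\dot\gamma(0))$ of a solution $\gamma$ with $(\gamma(t),\dot\gamma(t))\notin V$ for some $t\ge 0$. 2. If moreover $d\omega\neq 0$ at the origin of $\mathbb R^k$, then $d\mu=d(F^*\omega)$ is nonzero at every point of $M$. 3. In particular, if $k>1$, there is a smooth one-form $\omega$ on $\mathbb R^k$ such that the magnetic field $d(F^*\omega)$ is nonzero at every point of $M$. -/

import Mathlib

open scoped Manifold ContDiff Topology

noncomputable section

namespace MechLagrangian

/-- A differential form of degree `m` (without regularity) on a manifold `N` of dimension `n`. -/
abbrev DiffForm (n : ℕ) (N : Type*) [TopologicalSpace N]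
    [ChartedSpace (EuclideanSpace ℝ (Fin n)) N] (m : ℕ) :=
  (x : N) → TangentSpace (𝓡 n) x [⋀^Fin m]→L[ℝ] ℝ

/-- A differential form of degree `m` (without regularity) on the Euclidean space `ℝ^k`. -/
abbrev EuclForm (k m : ℕ) :=
  EuclideanSpace ℝ (Fin k) → EuclideanSpace ℝ (Fin k) [⋀^Fin m]→L[ℝ] ℝ

/-- A `C^2` Riemannian metric on the manifold `N` of dimension `n`. -/
abbrev Metric (n : ℕ) (N : Type*) [TopologicalSpace N]
    [ChartedSpace (EuclideanSpace ℝ (Fin n)) N] [IsManifold (𝓡 n) ∞ N] :=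
  Bundle.ContMDiffRiemannianMetric (𝓡 n) 2 (EuclideanSpace ℝ (Fin n))
    (fun x : N => TangentSpace (𝓡 n) x)

section Forms

variable {n : ℕ} {N : Type*} [TopologicalSpace N] [ChartedSpace (EuclideanSpace ℝ (Fin n)) N]

/-- The pullback `F^* θ` of a form on `ℝ^k` under a map `F : N → ℝ^k`. -/
def pullback {k m : ℕ} (F : N → EuclideanSpace ℝ (Fin k)) (θ : EuclForm k m) : DiffForm n N m :=
  fun x => (θ (F x)).compContinuousLinearMap (mfderiv (𝓡 n) (𝓡 k) F x)

/-- The expression of a form on `N` in the chart at `x₀`, that is, its pullback under the inverse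
of the chart (meaningful on the target of the chart). -/
def inChart {m : ℕ} (x₀ : N) (μ : DiffForm n N m) : EuclForm n m :=
  fun q => (μ ((extChartAt (𝓡 n) x₀).symm q)).compContinuousLinearMap
    (mfderiv (𝓡 n) (𝓡 n) (extChartAt (𝓡 n) x₀).symm q)

/-- The exterior derivative of a form on `N`: at `x` it is the exterior derivative of the
expression of the form in the chart at `x`, pulled back under this chart. -/
def extDer {m : ℕ} (μ : DiffForm n N m) : DiffForm n N (m + 1) :=
  fun x => (extDeriv (inChart x μ) (extChartAt (𝓡 n) x x)).compContinuousLinearMap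
    (mfderiv (𝓡 n) (𝓡 n) (extChartAt (𝓡 n) x) x)

end Forms

section Gradient

variable {n : ℕ} {N : Type*} [TopologicalSpace N] [ChartedSpace (EuclideanSpace ℝ (Fin n)) N]
  [IsManifold (𝓡 n) ∞ N]

theorem exists_gradient (ρ : Metric n N) (x : N) (α : TangentSpace (𝓡 n) x →L[ℝ] ℝ) :
    ∃ v : TangentSpace (𝓡 n) x, ∀ w : TangentSpace (𝓡 n) x, ρ.inner x v w = α w := by
  have : FiniteDimensional ℝ (TangentSpace (𝓡 n) x) :=
    inferInstanceAs (FiniteDimensional ℝ (EuclideanSpace ℝ (Fin n)))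
  let B : TangentSpace (𝓡 n) x →ₗ[ℝ] Module.Dual ℝ (TangentSpace (𝓡 n) x) :=
    ContinuousLinearMap.coeLM ℝ ∘ₗ (ρ.inner x).toLinearMap
  have hinj : Function.Injective B := by
    rw [injective_iff_map_eq_zero]
    intro v hv
    by_contra hne
    have h0 : ρ.inner x v v = 0 := LinearMap.congr_fun hv v
    exact (ρ.pos x v hne).ne' h0
  have hsurj : Function.Surjective B :=
    (LinearMap.injective_iff_surjective_of_finrank_eq_finrank
      (Subspace.dual_finrank_eq (K := ℝ) (V := TangentSpace (𝓡 n) x)).symm).1 hinj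
  obtain ⟨v, hv⟩ := hsurj α.toLinearMap
  exact ⟨v, fun w => LinearMap.congr_fun hv w⟩

/-- The gradient of `f` with respect to the metric `ρ`: the vector field with
`ρ (∇ f, w) = df (w)` for every tangent vector `w`. -/
def grad (ρ : Metric n N) (f : N → ℝ) (x : N) : TangentSpace (𝓡 n) x :=
  (exists_gradient ρ x (mfderiv (𝓡 n) 𝓘(ℝ, ℝ) f x)).choose

theorem inner_grad (ρ : Metric n N) (f : N → ℝ) (x : N) (w : TangentSpace (𝓡 n) x) :
    ρ.inner x (grad ρ f x) w = mfderiv (𝓡 n) 𝓘(ℝ, ℝ) f x w :=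
  (exists_gradient ρ x (mfderiv (𝓡 n) 𝓘(ℝ, ℝ) f x)).choose_spec w

/-- The vector field `∇ f / ‖∇ f‖^2`, meaningful off the critical points of `f`. -/
def normGrad (ρ : Metric n N) (f : N → ℝ) (x : N) : TangentSpace (𝓡 n) x :=
  (ρ.inner x (grad ρ f x) (grad ρ f x))⁻¹ • grad ρ f x

/-- The Lagrangian `L(x, v) = ‖v‖_x^2 / 2 + μ_x(v) - U(x)` on the tangent bundle. -/
def lagrangian (ρ : Metric n N) (μ : DiffForm n N 1) (U : N → ℝ) :
    TangentBundle (𝓡 n) N → ℝ :=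
  fun z => ρ.inner z.1 z.2 z.2 / 2 + μ z.1 (fun _ => z.2) - U z.1

end Gradient

section Dynamics

variable {n : ℕ} {N : Type*} [TopologicalSpace N] [ChartedSpace (EuclideanSpace ℝ (Fin n)) N]
  [IsManifold (𝓡 n) ∞ N]

/-- The point `(γ(t), γ'(t))` of the tangent bundle. -/
def phasePoint (γ : ℝ → N) (t : ℝ) : TangentBundle (𝓡 n) N :=
  ⟨γ t, mfderiv 𝓘(ℝ, ℝ) (𝓡 n) γ t (1 : ℝ)⟩

/-- The expression `(q, w) ↦ L(φ⁻¹(q), dφ⁻¹_q(w))` of a Lagrangian in the chart `φ` at `x₀`. -/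
def lagrangianInChart (L : TangentBundle (𝓡 n) N → ℝ) (x₀ : N)
    (q w : EuclideanSpace ℝ (Fin n)) : ℝ :=
  L ⟨(extChartAt (𝓡 n) x₀).symm q,
    mfderiv (𝓡 n) (𝓡 n) (extChartAt (𝓡 n) x₀).symm q w⟩

/-- The curve `γ` is a `C^2` solution of the Euler-Lagrange equations of `L` on the open interval
`(a, b)`: at every time `t` of this interval and in every chart around `γ(t)`, the coordinate
expression `q` of the curve satisfies `d/dt (∂L/∂w (q, q')) = ∂L/∂q (q, q')`. -/
def IsSolution (L : TangentBundle (𝓡 n) N → ℝ) (γ : ℝ → N) (a b : ℝ) : Prop :=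
  ContMDiffOn 𝓘(ℝ, ℝ) (𝓡 n) 2 γ (Set.Ioo a b) ∧
  ∀ t ∈ Set.Ioo a b, ∀ x₀ : N, γ t ∈ (extChartAt (𝓡 n) x₀).source →
    let q : ℝ → EuclideanSpace ℝ (Fin n) := fun s => extChartAt (𝓡 n) x₀ (γ s)
    HasDerivAt (fun s => fderiv ℝ (fun w => lagrangianInChart L x₀ (q s) w) (deriv q s))
      (fderiv ℝ (fun y => lagrangianInChart L x₀ y (deriv q t)) (q t)) t

/-- `(p, 0)` is an equilibrium point: the constant curve `p` is a solution for all times. -/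
def IsEquilibrium (L : TangentBundle (𝓡 n) N → ℝ) (p : N) : Prop :=
  ∀ a b : ℝ, IsSolution L (fun _ => p) a b

/-- Lyapunov stability of `(p, 0)`: for every neighborhood `V` of `(p, 0)` in the tangent bundle
there is a neighborhood `W` of `(p, 0)` such that every solution starting in `W` at time zero
stays in `V` at all later times at which it is defined. -/
def IsLyapunovStable (L : TangentBundle (𝓡 n) N → ℝ) (p : N) : Prop :=
  ∀ V ∈ 𝓝 (⟨p, 0⟩ : TangentBundle (𝓡 n) N), ∃ W ∈ 𝓝 (⟨p, 0⟩ : TangentBundle (𝓡 n) N),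
    ∀ (γ : ℝ → N) (a b : ℝ), a < 0 → 0 < b → IsSolution L γ a b → phasePoint γ 0 ∈ W →
      ∀ t ∈ Set.Ico 0 b, phasePoint γ t ∈ V

/-- `(p, 0)` is a Lyapunov unstable equilibrium point of the Lagrangian dynamics of `L`. -/
def IsLyapunovUnstableEquilibrium (L : TangentBundle (𝓡 n) N → ℝ) (p : N) : Prop :=
  IsEquilibrium L p ∧ ¬ IsLyapunovStable L p

end Dynamics

end MechLagrangian

end

/-! Near `p` the map `F` is a submersion with fibres of dimension `n - k > 0`, so there is a
nonvanishing vector field `Y` with `dF(Y) = 0` (`exists_vectorField_mem_ker_fderiv`). Along `Y` the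
potential `g ∘ F` does not change, `μ = F^*ω` vanishes, and so does `dμ(Y, ·)`
(`fderiv_pullback_of_mem_ker`): neither force is felt in this direction.

Start at `p` with velocity `ε Y(p)`. Since `U ≥ 0 = U(p)` and magnetic forces do no work, energy
conservation keeps the speed at most `B ε`. The quantity `I = ⟨γ', Y⟩` starts at `ε κ`, with `κ =
‖Y(p)‖^2`, and its derivative is purely quadratic in the velocity (`hasDerivAt_momentum`), hence
`O(ε^2)`. So `I` stays above `ε κ / 2` for a time of order `1 / ε`, in which the position moves by
an amount independent of `ε` (`drift_of_slowly_varying`). Arbitrarily small initial velocities thus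
lead out of a fixed ball (`exists_solution_leaving_ball`).

This is done in one chart, where solutions come from Hamilton's equations;
`eulerLagrange_change_coordinates` carries them to every chart. The equilibrium claim is Fermat's
lemma: `p` minimizes `U`.

The claims on `dμ` follow from `d F^* = F^* d`, because pulling back under a surjective linear map
is injective on forms. For `k > 1` the form `y_i dy_j` with `i ≠ j` serves. -/

noncomputable section

open Set Metric Filter

set_option maxSynthPendingDepth 3

namespace MechLagrangian

/-! ### Long-lived integral curves and first exit times -/

section

/-- A bounded Lipschitz vector field has integral curves on arbitrarily long intervals. -/
theorem exists_integralCurve_of_lipschitz_of_bounded {X : Type*} [NormedAddCommGroup X]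
    [NormedSpace ℝ X] [CompleteSpace X] {Z : X → X} {K L : NNReal} (hK : LipschitzWith K Z)
    (hL : ∀ x, ‖Z x‖ ≤ L) (x₀ : X) (T : ℝ) :
    ∃ z : ℝ → X, z 0 = x₀ ∧ ∀ t ∈ Ioo (-T) T, HasDerivAt z (Z (z t)) t := by
  rcases le_or_gt T 0 with hT | hT
  · exact ⟨fun _ => x₀, rfl, fun t ht => by
      have := ht.1.trans ht.2
      linarith⟩
  -- At speed at most `L` the curve stays within `L * T` of `x₀` up to time `T`, so this radius
  -- imposes no restriction on time.
  have h : IsPicardLindelof (fun _ => Z) (tmin := -T) (tmax := T)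
      ⟨0, by constructor <;> linarith⟩ x₀ (L * ⟨T, hT.le⟩) 0 L K :=
    { lipschitzOnWith := fun _ _ => hK.lipschitzOnWith
      continuousOn := fun _ _ => continuousOn_const
      norm_le := fun _ _ x _ => hL x
      mul_max_le := by
        simp only [sub_zero, zero_sub, neg_neg, max_self, NNReal.coe_zero]
        exact le_of_eq rfl }
  obtain ⟨z, hz0, hz⟩ := h.exists_eq_forall_mem_Icc_hasDerivWithinAt₀
  refine ⟨z, hz0, fun t ht => ?_⟩
  exact (hz t ⟨ht.1.le, ht.2.le⟩).hasDerivAt (Icc_mem_nhds ht.1 ht.2)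

/-- A vector field of class `C^1` at `x₀` agrees near `x₀` with a field having integral curves on
arbitrarily long intervals. -/
theorem exists_eventuallyEq_with_integralCurves {X : Type*} [NormedAddCommGroup X]
    [NormedSpace ℝ X] [FiniteDimensional ℝ X] {Z : X → X} {x₀ : X} (hZ : ContDiffAt ℝ 1 Z x₀) :
    ∃ Z' : X → X, (∀ᶠ x in 𝓝 x₀, Z' x = Z x) ∧
      ∀ (x : X) (T : ℝ), ∃ z : ℝ → X, z 0 = x ∧ ∀ t ∈ Ioo (-T) T, HasDerivAt z (Z' (z t)) t := by
  have : CompleteSpace X := FiniteDimensional.complete ℝ X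
  obtain ⟨r, hr, hrZ⟩ := Metric.eventually_nhds_iff_ball.1 (hZ.eventually (by simp))
  -- The support lies where `Z` is `C^1`, so `χ • Z` is globally `C^1` with compact support, hence
  -- bounded and Lipschitz.
  let χ : ContDiffBump x₀ := ⟨r / 4, r / 2, by linarith, by linarith⟩
  have hsm : ContDiff ℝ 1 (fun x => χ x • Z x) := by
    rw [contDiff_iff_contDiffAt]
    intro x
    by_cases hx : x ∈ ball x₀ r
    · exact χ.contDiffAt.smul (hrZ x hx)
    · have hx' : x ∉ tsupport χ := by
        rw [χ.tsupport_eq]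
        intro hx'
        exact hx (closedBall_subset_ball (show r / 2 < r by linarith) hx')
      have : (fun x => χ x • Z x) =ᶠ[𝓝 x] fun _ => 0 := by
        filter_upwards [notMem_tsupport_iff_eventuallyEq.1 hx'] with y hy
        simp [hy]
      exact contDiffAt_const.congr_of_eventuallyEq this
  have hcs : HasCompactSupport (fun x => χ x • Z x) := χ.hasCompactSupport.smul_right
  obtain ⟨K, hK⟩ := hsm.lipschitzWith_of_hasCompactSupport hcs (by simp)
  obtain ⟨C, hC⟩ := hcs.exists_bound_of_continuous hsm.continuous
  refine ⟨fun x => χ x • Z x, ?_, fun x T =>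
    exists_integralCurve_of_lipschitz_of_bounded hK (L := C.toNNReal)
      (fun y => (hC y).trans (Real.le_coe_toNNReal C)) x T⟩
  filter_upwards [χ.eventuallyEq_one] with x hx
  simp [hx]

/-- A continuous curve starting in an open set stays there or has a first exit time. -/
theorem forall_mem_or_exists_first_exit {X : Type*} [TopologicalSpace X] {z : ℝ → X} {T : ℝ}
    {U : Set X} (hz : ContinuousOn z (Icc 0 T)) (hU : IsOpen U) (h0 : z 0 ∈ U) :
    (∀ t ∈ Icc 0 T, z t ∈ U) ∨ ∃ τ ∈ Ioc 0 T, z τ ∉ U ∧ ∀ s ∈ Ico 0 τ, z s ∈ U := by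
  by_cases h : ∀ t ∈ Icc 0 T, z t ∈ U
  · exact Or.inl h
  push Not at h
  obtain ⟨t, ht, htU⟩ := h
  have hcl : IsClosed (Icc 0 T ∩ z ⁻¹' Uᶜ) := hz.preimage_isClosed_of_isClosed isClosed_Icc
    hU.isClosed_compl
  have hne : (Icc 0 T ∩ z ⁻¹' Uᶜ).Nonempty := ⟨t, ht, htU⟩
  have hbd : BddBelow (Icc 0 T ∩ z ⁻¹' Uᶜ) := ⟨0, fun s hs => hs.1.1⟩
  have hmem := hcl.csInf_mem hne hbd
  set τ := sInf (Icc 0 T ∩ z ⁻¹' Uᶜ)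
  have hτ0 : τ ≠ 0 := fun h => hmem.2 (h ▸ h0)
  refine Or.inr ⟨τ, ⟨lt_of_le_of_ne hmem.1.1 hτ0.symm, hmem.1.2⟩, hmem.2, fun s hs => ?_⟩
  by_contra hsU
  exact absurd (csInf_le hbd ⟨⟨hs.1, hs.2.le.trans hmem.1.2⟩, hsU⟩) (not_le.2 hs.2)

/-! ### Positive definite bilinear forms -/

section Forms

variable {E : Type*} [NormedAddCommGroup E] [NormedSpace ℝ E] [FiniteDimensional ℝ E]

/-- The constant is the minimum over the compact unit sphere, extended by homogeneity. The sphere is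
empty only in the zero space. -/
theorem exists_coercive_of_pos {B : E →L[ℝ] E →L[ℝ] ℝ} (hB : ∀ v, v ≠ 0 → 0 < B v v) :
    ∃ m > 0, ∀ v, m * ‖v‖ ^ 2 ≤ B v v := by
  have hc : Continuous fun v => B v v := by fun_prop
  rcases (sphere (0 : E) 1).eq_empty_or_nonempty with he | hne
  · refine ⟨1, one_pos, fun v => ?_⟩
    have hv : v = 0 := by
      by_contra hv
      have : ‖v‖⁻¹ • v ∈ sphere (0 : E) 1 := by
        simp [norm_smul, hv]
      simp [he] at this
    simp [hv]
  have : ProperSpace E := FiniteDimensional.proper ℝ E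
  obtain ⟨w, hw, hmin⟩ := (isCompact_sphere (0 : E) 1).exists_isMinOn hne hc.continuousOn
  refine ⟨B w w, hB w (by rintro rfl; simp at hw), fun v => ?_⟩
  rcases eq_or_ne v 0 with rfl | hv
  · simp
  have h1 : B w w ≤ B (‖v‖⁻¹ • v) (‖v‖⁻¹ • v) := hmin (by simp [norm_smul, hv])
  have hn : 0 < ‖v‖ := norm_pos_iff.2 hv
  simp only [map_smul, smul_apply, smul_eq_mul] at h1
  calc B w w * ‖v‖ ^ 2 ≤ (‖v‖⁻¹ * (‖v‖⁻¹ * B v v)) * ‖v‖ ^ 2 := by gcongr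
    _ = B v v := by field_simp

theorem isInvertible_of_pos {B : E →L[ℝ] E →L[ℝ] ℝ} (hB : ∀ v, v ≠ 0 → 0 < B v v) :
    B.IsInvertible := by
  have hinj : Function.Injective B := by
    rw [injective_iff_map_eq_zero]
    intro v hv
    by_contra hne
    have := hB v hne
    simp [hv] at this
  have hdim : Module.finrank ℝ E = Module.finrank ℝ (E →L[ℝ] ℝ) := by
    rw [← (LinearMap.toContinuousLinearMap (𝕜 := ℝ) (E := E) (F' := ℝ)).finrank_eq]
    exact (Subspace.dual_finrank_eq (K := ℝ) (V := E)).symm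
  exact ⟨(LinearEquiv.ofInjectiveOfFinrankEq B.toLinearMap hinj hdim).toContinuousLinearEquiv,
    by ext; rfl⟩

/-- Perturbing the form by less than `m / 2` in norm costs at most half of the coercivity.
Uniformity in `q` is what turns an energy bound into a speed bound. -/
theorem eventually_coercive {A : E → E →L[ℝ] E →L[ℝ] ℝ} {q₀ : E} (hA : ContinuousAt A q₀)
    (hpos : ∀ v, v ≠ 0 → 0 < A q₀ v v) :
    ∃ m > 0, ∀ᶠ q in 𝓝 q₀, ∀ v, m * ‖v‖ ^ 2 ≤ A q v v := by
  obtain ⟨m, hm, h⟩ := exists_coercive_of_pos hpos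
  refine ⟨m / 2, by positivity, ?_⟩
  filter_upwards [hA.eventually (eventually_norm_sub_lt (A q₀) (half_pos hm))] with q hq v
  have h1 : |(A q - A q₀) v v| ≤ m / 2 * ‖v‖ ^ 2 := by
    calc ‖(A q - A q₀) v v‖ ≤ ‖A q - A q₀‖ * ‖v‖ * ‖v‖ := (A q - A q₀).le_opNorm₂ v v
      _ ≤ m / 2 * ‖v‖ * ‖v‖ := by gcongr
      _ = _ := by ring
  have h2 := (abs_le.1 h1).1
  have h3 := h v
  simp only [sub_apply] at h2
  linarith

end Forms

end

/-! ### The drift estimate and the Lagrangian on a normed space -/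

section

/-- The kinematics of drift: if a quantity `I ≈ ℓ(q')` starts at `ε κ` and varies at rate `O(ε^2)`,
then `ℓ(q)` moves by an amount independent of `ε` in a time of order `1 / ε`. -/
theorem drift_of_slowly_varying {E : Type*} [NormedAddCommGroup E] [NormedSpace ℝ E]
    {q v : ℝ → E} {I I' : ℝ → ℝ} {ℓ : E →L[ℝ] ℝ} {κ C B δ ε : ℝ} (hκ : 0 < κ) (hC : 0 < C)
    (hB : 0 < B) (hε : 0 < ε) (hδ : δ * B ≤ κ / 4)
    (hq : ∀ t ∈ Icc 0 (κ / (2 * C * B ^ 2 * ε)), HasDerivAt q (v t) t)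
    (hI : ∀ t ∈ Icc 0 (κ / (2 * C * B ^ 2 * ε)), HasDerivAt I (I' t) t)
    (hv : ∀ t ∈ Icc 0 (κ / (2 * C * B ^ 2 * ε)), ‖v t‖ ≤ B * ε)
    (hI' : ∀ t ∈ Icc 0 (κ / (2 * C * B ^ 2 * ε)), |I' t| ≤ C * ‖v t‖ ^ 2)
    (hI0 : I 0 = ε * κ) (hδ0 : 0 ≤ δ)
    (hIℓ : ∀ t ∈ Icc 0 (κ / (2 * C * B ^ 2 * ε)), |I t - ℓ (v t)| ≤ δ * ‖v t‖) :
    κ ^ 2 / (8 * C * B ^ 2) ≤ ℓ (q (κ / (2 * C * B ^ 2 * ε)) - q 0) := by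
  set T := κ / (2 * C * B ^ 2 * ε) with hT
  have hT0 : 0 < T := by positivity
  -- `T` is the time in which the largest possible rate `C (B ε)^2` uses up half of the initial
  -- value `ε κ`.
  have hTe : C * B ^ 2 * ε ^ 2 * T = ε * κ / 2 := by
    rw [hT]; field_simp
  have hlow : ∀ t ∈ Icc 0 T, ε * κ / 2 ≤ I t := by
    intro t ht
    rcases ht.1.eq_or_lt with rfl | ht0
    · rw [hI0]; nlinarith [mul_pos hε hκ]
    obtain ⟨c, hc, hce⟩ := exists_hasDerivAt_eq_slope I I' ht0
      (fun s hs => (hI s ⟨hs.1, hs.2.trans ht.2⟩).continuousAt.continuousWithinAt)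
      (fun s hs => hI s ⟨hs.1.le, hs.2.le.trans ht.2⟩)
    have hcT : c ∈ Icc 0 T := ⟨hc.1.le, hc.2.le.trans ht.2⟩
    have h1 : -(C * (B * ε) ^ 2) ≤ I' c := by
      have h2 := (abs_le.1 (hI' c hcT)).1
      have h3 : ‖v c‖ ^ 2 ≤ (B * ε) ^ 2 := by gcongr; exact hv c hcT
      nlinarith
    have h4 : I t - I 0 = I' c * t := by rw [hce]; field_simp; ring
    have h5 : -(C * (B * ε) ^ 2) * T ≤ I' c * t := by
      calc -(C * (B * ε) ^ 2) * T ≤ -(C * (B * ε) ^ 2) * t := by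
            have : 0 ≤ C * (B * ε) ^ 2 := by positivity
            nlinarith [ht.2]
        _ ≤ I' c * t := by gcongr
    have h6 : -(C * (B * ε) ^ 2) * T = - (ε * κ / 2) := by rw [← hTe]; ring
    linarith
  obtain ⟨c, hc, hce⟩ := exists_hasDerivAt_eq_slope (fun t => ℓ (q t)) (fun t => ℓ (v t)) hT0
      (fun s hs => (ℓ.continuous.continuousAt.comp
        (hq s hs).continuousAt).continuousWithinAt)
      (fun s hs => ℓ.hasFDerivAt.comp_hasDerivAt s (hq s ⟨hs.1.le, hs.2.le⟩))
  have hcT : c ∈ Icc 0 T := ⟨hc.1.le, hc.2.le⟩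
  -- The error `δ B ε` takes at most `ε κ / 4` from `I ≥ ε κ / 2`. Multiplied by `T`, the remaining
  -- speed gives a displacement free of `ε`.
  have h1 : ε * κ / 4 ≤ ℓ (v c) := by
    have h2 := (abs_le.1 (hIℓ c hcT)).2
    have h3 := hlow c hcT
    have h4 : δ * ‖v c‖ ≤ δ * (B * ε) := by gcongr; exact hv c hcT
    nlinarith
  have h2 : ℓ (q T - q 0) = ℓ (v c) * T := by
    rw [map_sub, hce, sub_zero, div_mul_cancel₀ _ hT0.ne']
  rw [h2]
  calc κ ^ 2 / (8 * C * B ^ 2) = ε * κ / 4 * T := by rw [hT]; field_simp; ring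
    _ ≤ _ := by gcongr

section Lag

variable {E : Type*} [NormedAddCommGroup E] [NormedSpace ℝ E]

/-- The Lagrangian `(q, w) ↦ A_q(w, w) / 2 + β_q(w) - u(q)` on a normed space. -/
def lag (A : E → E →L[ℝ] E →L[ℝ] ℝ) (β : E → E →L[ℝ] ℝ) (u : E → ℝ) (q w : E) : ℝ :=
  A q w w / 2 + β q w - u q

variable {A : E → E →L[ℝ] E →L[ℝ] ℝ} {β : E → E →L[ℝ] ℝ} {u : E → ℝ}

theorem contDiffAt_lag {n : WithTop ℕ∞} {q : E} (hA : ContDiffAt ℝ n A q)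
    (hβ : ContDiffAt ℝ n β q) (hu : ContDiffAt ℝ n u q) (w : E) :
    ContDiffAt ℝ n (Function.uncurry (lag A β u)) (q, w) := by
  have h1 : ContDiffAt ℝ n (fun x : E × E => x.1) (q, w) := contDiffAt_fst
  have h2 : ContDiffAt ℝ n (fun x : E × E => x.2) (q, w) := contDiffAt_snd
  have hA' := hA.comp (q, w) h1
  have hβ' := hβ.comp (q, w) h1
  have hu' := hu.comp (q, w) h1
  exact ((((hA'.clm_apply h2).clm_apply h2).div_const 2).add (hβ'.clm_apply h2)).sub hu'

theorem fderiv_lag_vel {q : E} (hs : ∀ v w, A q v w = A q w v) (w : E) :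
    fderiv ℝ (lag A β u q) w = A q w + β q := by
  have h1 : HasFDerivAt (fun w => A q w w) ((A q w).comp (.id ℝ E) + (A q).flip w) w :=
    ((A q).hasFDerivAt.clm_apply (hasFDerivAt_id w))
  have h2 : HasFDerivAt (lag A β u q)
      ((2 : ℝ)⁻¹ • ((A q w).comp (.id ℝ E) + (A q).flip w) + β q) w := by
    have := ((h1.const_mul (2 : ℝ)⁻¹).add (β q).hasFDerivAt).sub_const (u q)
    refine this.congr_of_eventuallyEq (Eventually.of_forall fun x => ?_)
    simp [lag]; ring
  rw [h2.fderiv]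
  ext h
  simp [hs h w]; ring

theorem fderiv_lag_pos {q : E} (hA : DifferentiableAt ℝ A q) (hβ : DifferentiableAt ℝ β q)
    (hu : DifferentiableAt ℝ u q) (w h : E) :
    fderiv ℝ (fun y => lag A β u y w) q h =
      fderiv ℝ A q h w w / 2 + fderiv ℝ β q h w - fderiv ℝ u q h := by
  have h1 : HasFDerivAt (fun y => A y w w) (((fderiv ℝ A q).flip w).flip w) q := by
    have h0 := hA.hasFDerivAt.clm_apply (hasFDerivAt_const w q)
    have h1 := h0.clm_apply (hasFDerivAt_const w q)
    refine h1.congr_fderiv ?_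
    ext; simp
  have h2 : HasFDerivAt (fun y => β y w) ((fderiv ℝ β q).flip w) q := by
    refine (hβ.hasFDerivAt.clm_apply (hasFDerivAt_const w q)).congr_fderiv ?_
    ext; simp
  have h3 := ((h1.const_mul (2 : ℝ)⁻¹).add h2).sub hu.hasFDerivAt
  have h4 : HasFDerivAt (fun y => lag A β u y w) _ q :=
    h3.congr_of_eventuallyEq (Eventually.of_forall fun x => by simp [lag]; ring)
  rw [h4.fderiv]
  simp; ring

end Lag

end

/-! ### Energy, momentum along a field, and Hamilton's equations -/

section

section Lag

variable {E : Type*} [NormedAddCommGroup E] [NormedSpace ℝ E]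
  {A : E → E →L[ℝ] E →L[ℝ] ℝ} {β : E → E →L[ℝ] ℝ} {u : E → ℝ}

/-- Pair the Euler–Lagrange equations with the velocity: the term `Dβ(v) v` occurs on both sides and
cancels, as a magnetic force does no work. -/
theorem hasDerivAt_energy {q v : ℝ → E} {t : ℝ} {v' : E}
    (hA : DifferentiableAt ℝ A (q t)) (hβ : DifferentiableAt ℝ β (q t))
    (hu : DifferentiableAt ℝ u (q t)) (hs : ∀ v w, A (q t) v w = A (q t) w v)
    (hq : HasDerivAt q (v t) t) (hv : HasDerivAt v v' t)
    (hp : HasDerivAt (fun s => A (q s) (v s) + β (q s))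
      (fderiv ℝ (fun y => lag A β u y (v t)) (q t)) t) :
    HasDerivAt (fun s => A (q s) (v s) (v s) / 2 + u (q s)) 0 t := by
  have hAq := hA.hasFDerivAt.comp_hasDerivAt t hq
  have hβq := hβ.hasFDerivAt.comp_hasDerivAt t hq
  have huq := hu.hasFDerivAt.comp_hasDerivAt t hq
  have hAv := hAq.clm_apply hv
  have hAvv := hAv.clm_apply hv
  have hEL := congrArg (fun φ : E →L[ℝ] ℝ => φ (v t)) ((hAv.add hβq).unique hp)
  rw [fderiv_lag_pos hA hβ hu] at hEL
  refine ((hAvv.div_const 2).add huq).congr_deriv ?_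
  simp only [add_apply, Function.comp_apply] at hEL ⊢
  have := hs v' (v t)
  linarith

/-- Since `β(Y) = 0`, this quantity is the full momentum paired with `Y`. Given `β(Y) = 0`, the
hypothesis `hYβ'` says `dβ(Y, v) = 0`; it removes the terms linear in the velocity, `hYu` removes
the constant one, and only quadratic terms survive. -/
theorem hasDerivAt_momentum {q v : ℝ → E} {t : ℝ} {Y : E → E}
    (hA : DifferentiableAt ℝ A (q t)) (hβ : DifferentiableAt ℝ β (q t))
    (hu : DifferentiableAt ℝ u (q t)) (hY : DifferentiableAt ℝ Y (q t))
    (hq : HasDerivAt q (v t) t)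
    (hp : HasDerivAt (fun s => A (q s) (v s) + β (q s))
      (fderiv ℝ (fun y => lag A β u y (v t)) (q t)) t)
    (hYβ : ∀ᶠ y in 𝓝 (q t), β y (Y y) = 0) (hYu : fderiv ℝ u (q t) (Y (q t)) = 0)
    (hYβ' : fderiv ℝ β (q t) (Y (q t)) (v t) + β (q t) (fderiv ℝ Y (q t) (v t)) = 0) :
    HasDerivAt (fun s => A (q s) (v s) (Y (q s)))
      (fderiv ℝ A (q t) (Y (q t)) (v t) (v t) / 2 + A (q t) (v t) (fderiv ℝ Y (q t) (v t))) t := by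
  have hYq := hY.hasFDerivAt.comp_hasDerivAt t hq
  have h1 := hp.clm_apply hYq
  rw [fderiv_lag_pos hA hβ hu] at h1
  refine (h1.congr_of_eventuallyEq ?_).congr_deriv ?_
  · filter_upwards [hq.continuousAt.eventually hYβ] with s hs
    simp [hs]
  · simp only [add_apply, Function.comp_apply, hYu]
    linarith

theorem abs_momentum_deriv_le {a : E →L[ℝ] E →L[ℝ] ℝ} {a' : E →L[ℝ] E →L[ℝ] E →L[ℝ] ℝ} {y : E}
    {y' : E →L[ℝ] E} {a₁ a₂ a₃ a₄ : ℝ} (h1 : ‖a‖ ≤ a₁) (h2 : ‖a'‖ ≤ a₂) (h3 : ‖y‖ ≤ a₃)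
    (h4 : ‖y'‖ ≤ a₄) (v : E) :
    |a' y v v / 2 + a v (y' v)| ≤ (a₂ * a₃ + a₁ * a₄) * ‖v‖ ^ 2 := by
  have p1 : 0 ≤ a₁ := (norm_nonneg _).trans h1
  have p2 : 0 ≤ a₂ := (norm_nonneg _).trans h2
  have p3 : 0 ≤ a₃ := (norm_nonneg _).trans h3
  have e1 : ‖a' y v v‖ ≤ a₂ * a₃ * ‖v‖ ^ 2 := by
    calc ‖a' y v v‖ ≤ ‖a' y‖ * ‖v‖ * ‖v‖ := (a' y).le_opNorm₂ v v
      _ ≤ (a₂ * a₃) * ‖v‖ * ‖v‖ := by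
        gcongr
        exact (a'.le_opNorm y).trans (by gcongr)
      _ = _ := by ring
  have e2 : ‖a v (y' v)‖ ≤ a₁ * a₄ * ‖v‖ ^ 2 := by
    calc ‖a v (y' v)‖ ≤ ‖a‖ * ‖v‖ * ‖y' v‖ := a.le_opNorm₂ v _
      _ ≤ a₁ * ‖v‖ * (a₄ * ‖v‖) := by
        gcongr
        exact (y'.le_opNorm v).trans (by gcongr)
      _ = _ := by ring
  have e3 : 0 ≤ ‖a' y v v‖ := norm_nonneg _
  calc |a' y v v / 2 + a v (y' v)| ≤ |a' y v v / 2| + |a v (y' v)| := abs_add_le _ _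
    _ = ‖a' y v v‖ / 2 + ‖a v (y' v)‖ := by rw [abs_div, abs_two]; rfl
    _ ≤ _ := by linarith

variable (A β u) in
/-- The velocity as a function of position and momentum. -/
def vel (x : E × (E →L[ℝ] ℝ)) : E := (A x.1).inverse (x.2 - β x.1)

variable (A β u) in
/-- The vector field of Hamilton's equations of the Lagrangian `lag A β u`. -/
def hamField (x : E × (E →L[ℝ] ℝ)) : E × (E →L[ℝ] ℝ) :=
  (vel A β x, fderiv ℝ (fun y => lag A β u y (vel A β x)) x.1)

theorem apply_vel {x : E × (E →L[ℝ] ℝ)} (hinv : (A x.1).IsInvertible) :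
    A x.1 (vel A β x) + β x.1 = x.2 := by
  rw [vel, hinv.self_apply_inverse]
  simp

variable [FiniteDimensional ℝ E]

theorem contDiffAt_vel {n : WithTop ℕ∞} {x : E × (E →L[ℝ] ℝ)} (hA : ContDiffAt ℝ n A x.1)
    (hβ : ContDiffAt ℝ n β x.1) (hinv : (A x.1).IsInvertible) : ContDiffAt ℝ n (vel A β) x := by
  have : CompleteSpace E := FiniteDimensional.complete ℝ E
  have h1 : ContDiffAt ℝ n (fun y : E × (E →L[ℝ] ℝ) => y.1) x := contDiffAt_fst
  have h2 : ContDiffAt ℝ n (fun y : E × (E →L[ℝ] ℝ) => y.2) x := contDiffAt_snd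
  obtain ⟨e, he⟩ := hinv
  have hi : ContDiffAt ℝ n ContinuousLinearMap.inverse (A x.1) := he ▸ contDiffAt_map_inverse e
  exact (hi.comp x (hA.comp x h1)).clm_apply (h2.sub (hβ.comp x h1))

/-- The force differentiates the Lagrangian once, so `C^2` data give a `C^1` field, just enough for
Picard–Lindelöf after a cutoff. -/
theorem contDiffAt_hamField {x : E × (E →L[ℝ] ℝ)} (hA : ContDiffAt ℝ 2 A x.1)
    (hβ : ContDiffAt ℝ 2 β x.1) (hu : ContDiffAt ℝ 2 u x.1) (hinv : (A x.1).IsInvertible) :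
    ContDiffAt ℝ 1 (hamField A β u) x := by
  have hvel := contDiffAt_vel hA hβ hinv
  refine (hvel.of_le one_le_two).prodMk ?_
  refine ContDiffAt.fderiv (n := 2) (f := fun x y => lag A β u y (vel A β x))
    (g := fun x : E × (E →L[ℝ] ℝ) => x.1) ?_ contDiffAt_fst (by norm_num)
  have h1 : ContDiffAt ℝ 2 (fun y : (E × (E →L[ℝ] ℝ)) × E => (y.2, vel A β y.1)) (x, x.1) :=
    contDiffAt_snd.prodMk (hvel.comp (x, x.1) contDiffAt_fst)
  exact (contDiffAt_lag hA hβ hu (vel A β x)).comp (x, x.1) h1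

end Lag

end

/-! ### From Hamilton's equations to escaping solutions -/

section

theorem contDiffOn_succ_of_hasDerivAt {E : Type*} [NormedAddCommGroup E] [NormedSpace ℝ E]
    {f f' : ℝ → E} {s : Set ℝ} {n : ℕ} (hs : IsOpen s) (hf : ∀ t ∈ s, HasDerivAt f (f' t) t)
    (hf' : ContDiffOn ℝ n f' s) : ContDiffOn ℝ (n + 1) f s := by
  rw [contDiffOn_succ_iff_deriv_of_isOpen hs]
  exact ⟨fun t ht => (hf t ht).differentiableAt.differentiableWithinAt, by simp,
    hf'.congr fun t ht => (hf t ht).deriv⟩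

theorem eventually_norm_le {X G : Type*} [TopologicalSpace X] [NormedAddCommGroup G] {f : X → G}
    {x₀ : X} (hf : ContinuousAt f x₀) : ∀ᶠ x in 𝓝 x₀, ‖f x‖ ≤ ‖f x₀‖ + 1 := by
  filter_upwards [hf.norm.eventually (eventually_lt_nhds (lt_add_one _))] with x hx using hx.le

variable {E : Type*} [NormedAddCommGroup E] [NormedSpace ℝ E]
  {A : E → E →L[ℝ] E →L[ℝ] ℝ} {β : E → E →L[ℝ] ℝ} {u : E → ℝ}

variable (A β u) in
/-- The curve `q` solves the Euler–Lagrange equations of `lag A β u` on the interval `(a, b)`. -/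
def SolvesEulerLagrange (q : ℝ → E) (a b : ℝ) : Prop :=
  ∀ t ∈ Ioo a b, HasDerivAt (fun s => fderiv ℝ (lag A β u (q s)) (deriv q s))
    (fderiv ℝ (fun y => lag A β u y (deriv q t)) (q t)) t

theorem hasDerivAt_of_hamField {z : ℝ → E × (E →L[ℝ] ℝ)} {t : ℝ}
    (hz : HasDerivAt z (hamField A β u (z t)) t)
    (hinv : ∀ᶠ x in 𝓝 (z t), (A x.1).IsInvertible) :
    HasDerivAt (fun s => (z s).1) (vel A β (z t)) t ∧
    HasDerivAt (fun s => A (z s).1 (vel A β (z s)) + β (z s).1)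
      (fderiv ℝ (fun y => lag A β u y (vel A β (z t))) (z t).1) t := by
  refine ⟨hz.fst, HasDerivAt.congr_of_eventuallyEq hz.snd ?_⟩
  filter_upwards [hz.continuousAt.eventually hinv] with s hs
  exact apply_vel hs

variable [FiniteDimensional ℝ E]

/-- Integral curves of the Hamiltonian field project to solutions of the Euler–Lagrange
equations. -/
theorem solvesEulerLagrange_of_hamField {z : ℝ → E × (E →L[ℝ] ℝ)} {a b : ℝ}
    (hz : ∀ t ∈ Ioo a b, HasDerivAt z (hamField A β u (z t)) t)
    (hA : ∀ t ∈ Ioo a b, ContDiffAt ℝ 2 A (z t).1) (hβ : ∀ t ∈ Ioo a b, ContDiffAt ℝ 2 β (z t).1)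
    (hu : ∀ t ∈ Ioo a b, ContDiffAt ℝ 2 u (z t).1)
    (hs : ∀ t ∈ Ioo a b, ∀ v w, A (z t).1 v w = A (z t).1 w v)
    (hinv : ∀ t ∈ Ioo a b, ∀ᶠ x in 𝓝 (z t), (A x.1).IsInvertible) :
    SolvesEulerLagrange A β u (fun s => (z s).1) a b ∧
      ContDiffOn ℝ 2 (fun s => (z s).1) (Ioo a b) := by
  have hd : ∀ t ∈ Ioo a b, deriv (fun s => (z s).1) t = vel A β (z t) := fun t ht =>
    (hasDerivAt_of_hamField (hz t ht) (hinv t ht)).1.deriv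
  constructor
  · intro t ht
    rw [hd t ht]
    refine (hasDerivAt_of_hamField (hz t ht) (hinv t ht)).2.congr_of_eventuallyEq ?_
    filter_upwards [isOpen_Ioo.mem_nhds ht] with s hs'
    rw [hd s hs', fderiv_lag_vel (hs s hs')]
  -- Bootstrap: continuity of `z` makes its derivative continuous, so `z` is `C^1`; then the
  -- velocity is `C^1` and the position gains a second derivative.
  · have hzc : ContinuousOn z (Ioo a b) := fun t ht => (hz t ht).continuousAt.continuousWithinAt
    have hz1 : ContDiffOn ℝ 1 z (Ioo a b) := by
      have h0 : ContDiffOn ℝ (0 : ℕ) (fun t => hamField A β u (z t)) (Ioo a b) := by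
        rw [Nat.cast_zero, contDiffOn_zero]
        exact fun t ht => (contDiffAt_hamField (hA t ht) (hβ t ht) (hu t ht)
          (hinv t ht).self_of_nhds).continuousAt.comp_continuousWithinAt (hzc t ht)
      simpa using contDiffOn_succ_of_hasDerivAt isOpen_Ioo hz h0
    have hv1 : ContDiffOn ℝ (1 : ℕ) (fun t => vel A β (z t)) (Ioo a b) := fun t ht =>
      ((contDiffAt_vel (hA t ht) (hβ t ht) (hinv t ht).self_of_nhds).of_le
        one_le_two).comp_contDiffWithinAt t (hz1 t ht)
    have := contDiffOn_succ_of_hasDerivAt isOpen_Ioo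
      (fun t ht => (hasDerivAt_of_hamField (hz t ht) (hinv t ht)).1) hv1
    simpa [one_add_one_eq_two] using this

/-- Solutions of the Euler–Lagrange equations starting at a zero `q₀` of the potential `u ≥ 0`, with
arbitrarily small velocity in the direction of a field `Y` on which neither the potential nor the
magnetic force acts, leave a fixed neighborhood of `q₀`. -/
theorem exists_solution_leaving_ball {q₀ : E} {Y : E → E} {Ω : Set E} (hΩ : Ω ∈ 𝓝 q₀)
    (hA : ContDiffAt ℝ 2 A q₀) (hβ : ContDiffAt ℝ 2 β q₀) (hu : ContDiffAt ℝ 2 u q₀)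
    (hY : ContDiffAt ℝ 1 Y q₀) (hsymm : ∀ᶠ q in 𝓝 q₀, ∀ v w, A q v w = A q w v)
    (hpos : ∀ v, v ≠ 0 → 0 < A q₀ v v) (hu0 : u q₀ = 0) (hunn : ∀ᶠ q in 𝓝 q₀, 0 ≤ u q)
    (hY0 : Y q₀ ≠ 0) (hYβ : ∀ᶠ q in 𝓝 q₀, β q (Y q) = 0)
    (hYu : ∀ᶠ q in 𝓝 q₀, fderiv ℝ u q (Y q) = 0)
    (hYβ' : ∀ᶠ q in 𝓝 q₀, ∀ v, fderiv ℝ β q (Y q) v + β q (fderiv ℝ Y q v) = 0) :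
    ∃ r > 0, ∀ᶠ ε in 𝓝[>] (0 : ℝ), ∃ (q : ℝ → E) (a b : ℝ), a < 0 ∧ 0 < b ∧ q 0 = q₀ ∧
      HasDerivAt q (ε • Y q₀) 0 ∧ ContDiffOn ℝ 2 q (Ioo a b) ∧ (∀ t ∈ Ioo a b, q t ∈ Ω) ∧
      SolvesEulerLagrange A β u q a b ∧ ∃ t ∈ Ico 0 b, q t ∉ ball q₀ r := by
  have hκ := hpos _ hY0
  set κ := A q₀ (Y q₀) (Y q₀) with hκdef
  set ℓ := A q₀ (Y q₀) with hℓdef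
  obtain ⟨m, hm, hcoer⟩ := eventually_coercive hA.continuousAt hpos
  -- The initial energy is `ε^2 κ / 2`, so coercivity gives `m ‖v‖^2 ≤ ε^2 κ`, that is, `‖v‖ ≤ B ε`.
  set B := √(κ / m) with hBdef
  have hB : 0 < B := Real.sqrt_pos.2 (by positivity)
  have hB2 : m * B ^ 2 = κ := by
    rw [hBdef, Real.sq_sqrt (by positivity)]; field_simp
  set δ := κ / (4 * B) with hδdef
  have hδ : 0 < δ := by positivity
  have hδB : δ * B ≤ κ / 4 := by rw [hδdef]; apply le_of_eq; field_simp
  set a₁ := ‖A q₀‖ + 1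
  set a₂ := ‖fderiv ℝ A q₀‖ + 1
  set a₃ := ‖Y q₀‖ + 1
  set a₄ := ‖fderiv ℝ Y q₀‖ + 1
  set C := a₂ * a₃ + a₁ * a₄
  have hC : 0 < C := by positivity
  -- Freezing `A` and `Y` at `q₀` replaces `I` by the fixed functional `ℓ` of the velocity, with the
  -- error allowed by the drift estimate.
  have hflip : ∀ᶠ q in 𝓝 q₀, ∀ v, |A q v (Y q) - ℓ v| ≤ δ * ‖v‖ := by
    have hc : ContinuousAt (fun q => (A q).flip (Y q)) q₀ :=
      ((ContinuousLinearMap.flipₗᵢ ℝ E E ℝ).continuous.continuousAt.comp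
        hA.continuousAt).clm_apply hY.continuousAt
    filter_upwards [hc.eventually (eventually_norm_sub_lt _ hδ)] with q hq v
    have := ((A q).flip (Y q) - (A q₀).flip (Y q₀)).le_of_opNorm_le hq.le v
    simpa [hsymm.self_of_nhds v (Y q₀)] using this
  have hgood := (show ∀ᶠ q in 𝓝 q₀, q ∈ Ω from hΩ).and <| hcoer.and <| hsymm.and <| (hA.eventually (by simp)).and <|
    (hβ.eventually (by simp)).and <| (hu.eventually (by simp)).and <|
    (hY.eventually (by simp)).and <| (eventually_norm_le hA.continuousAt).and <|
    (eventually_norm_le (hA.fderiv_right (m := 1) (by norm_num)).continuousAt).and <|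
    (eventually_norm_le hY.continuousAt).and <| (eventually_norm_le (hY.fderiv_right (m := 0) (by norm_num)).continuousAt).and <|
    hunn.and <| hYβ.eventually_nhds.and <| hYu.and <| hYβ'.and hflip
  set x₀ : E × (E →L[ℝ] ℝ) := (q₀, β q₀) with hx₀
  obtain ⟨Z', hZ', hex⟩ := exists_eventuallyEq_with_integralCurves
    (contDiffAt_hamField (x := x₀) hA hβ hu (isInvertible_of_pos hpos))
  obtain ⟨d, hd, hball⟩ := Metric.eventually_nhds_iff_ball.1
    (hZ'.and ((continuous_fst.tendsto x₀).eventually hgood))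
  obtain ⟨r', hr', hβr⟩ := Metric.eventually_nhds_iff_ball.1
    (hβ.continuousAt.eventually (eventually_norm_sub_lt (β q₀) (show 0 < d / 4 by positivity)))
  -- In the ball of radius `r`, `ℓ(q - q₀)` stays below the guaranteed drift, so the curve cannot
  -- remain there up to time `T`.
  obtain ⟨r, hr, hrr', hrd, hrℓ⟩ : ∃ r > 0, r < r' ∧ r ≤ d / 2 ∧
      ‖ℓ‖ * r < κ ^ 2 / (8 * C * B ^ 2) := by
    have h1 : Tendsto (fun r => ‖ℓ‖ * r) (𝓝[>] 0) (𝓝 0) := by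
      have : Continuous fun r : ℝ => ‖ℓ‖ * r := by fun_prop
      simpa using (this.tendsto 0).mono_left nhdsWithin_le_nhds
    have h2 := (h1.eventually (eventually_lt_nhds
      (show 0 < κ ^ 2 / (8 * C * B ^ 2) by positivity))).and
      ((show ∀ᶠ r in 𝓝[>] (0 : ℝ), r ∈ Ioo 0 r' from Ioo_mem_nhdsGT hr').and
        (show ∀ᶠ r in 𝓝[>] (0 : ℝ), r ∈ Ioo 0 (d / 2) from Ioo_mem_nhdsGT (half_pos hd)))
    obtain ⟨r, h3, h4, h5⟩ := h2.exists
    exact ⟨r, h4.1, h4.2, h5.2.le, h3⟩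
  refine ⟨r, hr, ?_⟩
  have hε1 : ∀ᶠ ε in 𝓝[>] (0 : ℝ), ‖ε • ℓ‖ < d / 2 := by
    have : Continuous fun ε : ℝ => ‖ε • ℓ‖ := by fun_prop
    have h1 := (this.tendsto 0).mono_left (nhdsWithin_le_nhds (s := Ioi 0))
    simp only [zero_smul, norm_zero] at h1
    exact h1.eventually (eventually_lt_nhds (half_pos hd))
  have hε2 : ∀ᶠ ε in 𝓝[>] (0 : ℝ), a₁ * B * ε < d / 4 := by
    have : Continuous fun ε : ℝ => a₁ * B * ε := by fun_prop
    have h1 := (this.tendsto 0).mono_left (nhdsWithin_le_nhds (s := Ioi 0))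
    simp only [mul_zero] at h1
    exact h1.eventually (eventually_lt_nhds (by positivity))
  filter_upwards [hε1, hε2, self_mem_nhdsWithin] with ε hε1 hε2 (hε : 0 < ε)
  set T := κ / (2 * C * B ^ 2 * ε) with hT
  have hT0 : 0 < T := by positivity
  -- The momentum `β q₀ + ε • ℓ` corresponds to the velocity `ε • Y q₀`. The extra unit of time
  -- provides two-sided derivatives at `0` and `T`.
  obtain ⟨z, hz0, hz⟩ := hex (q₀, β q₀ + ε • ℓ) (T + 1)
  have hIcc : ∀ t ∈ Icc 0 T, t ∈ Ioo (-(T + 1)) (T + 1) := fun t ht =>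
    ⟨by linarith [ht.1], by linarith [ht.2]⟩
  have hinv : ∀ x ∈ ball x₀ d, (A x.1).IsInvertible := fun x hx =>
    isInvertible_of_pos fun v hv => lt_of_lt_of_le
      (by have := norm_pos_iff.2 hv; positivity) ((hball x hx).2.2.1 v)
  have hinv' : ∀ x ∈ ball x₀ d, ∀ᶠ x in 𝓝 x, (A x.1).IsInvertible := fun x hx => by
    filter_upwards [isOpen_ball.mem_nhds hx] with y hy using hinv y hy
  have hham : ∀ t ∈ Ioo (-(T + 1)) (T + 1), z t ∈ ball x₀ d →
      HasDerivAt z (hamField A β u (z t)) t := fun t ht htd => (hball _ htd).1 ▸ hz t ht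
  have hzc : ContinuousOn z (Icc 0 T) := fun t ht =>
    (hz t (hIcc t ht)).continuousAt.continuousWithinAt
  have hv0 : vel A β (z 0) = ε • Y q₀ := by
    rw [hz0, vel, add_sub_cancel_left, map_smul, hℓdef,
      (isInvertible_of_pos hpos).inverse_apply_self]
  -- conservation of energy bounds the speed
  have hspeed : ∀ τ ∈ Icc 0 T, (∀ s ∈ Icc 0 τ, z s ∈ ball x₀ d) →
      ‖vel A β (z τ)‖ ≤ B * ε := by
    intro τ hτ hin
    have hE : ∀ s ∈ Icc 0 τ, HasDerivAt
        (fun s => A (z s).1 (vel A β (z s)) (vel A β (z s)) / 2 + u (z s).1) 0 s := by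
      intro s hs
      have hsd := hin s hs
      have hsT := hIcc s ⟨hs.1, hs.2.trans hτ.2⟩
      obtain ⟨-, -, -, hs2, hsA, hsβ, hsu, -⟩ := hball _ hsd
      have h1 := hham s hsT hsd
      have h2 := hasDerivAt_of_hamField h1 (hinv' _ hsd)
      have h3 := ((contDiffAt_vel hsA hsβ (hinv _ hsd)).differentiableAt
        two_ne_zero).hasFDerivAt.comp_hasDerivAt s h1
      exact hasDerivAt_energy (q := fun s => (z s).1) (hsA.differentiableAt two_ne_zero)
        (hsβ.differentiableAt two_ne_zero) (hsu.differentiableAt two_ne_zero) hs2 h2.1 h3 h2.2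
    have hconst : A (z τ).1 (vel A β (z τ)) (vel A β (z τ)) / 2 + u (z τ).1 = ε ^ 2 * κ / 2 := by
      have h0 : A (z 0).1 (vel A β (z 0)) (vel A β (z 0)) / 2 + u (z 0).1 = ε ^ 2 * κ / 2 := by
        rw [hv0, hz0]
        simp only [hu0, map_smul, smul_apply, smul_eq_mul]
        ring
      rw [← h0]
      exact constant_of_has_deriv_right_zero
        (f := fun s => A (z s).1 (vel A β (z s)) (vel A β (z s)) / 2 + u (z s).1)
        (fun s hs => (hE s hs).continuousAt.continuousWithinAt)
        (fun s hs => (hE s ⟨hs.1, hs.2.le⟩).hasDerivWithinAt) τ ⟨hτ.1, le_rfl⟩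
    obtain ⟨-, -, hco, -, -, -, -, -, -, -, -, -, hun, -⟩ := hball _ (hin τ ⟨hτ.1, le_rfl⟩)
    have h1 := hco (vel A β (z τ))
    have h2 : m * ‖vel A β (z τ)‖ ^ 2 ≤ m * (B * ε) ^ 2 := by
      calc _ ≤ ε ^ 2 * κ := by linarith
        _ = _ := by rw [← hB2]; ring
    exact (pow_le_pow_iff_left₀ (norm_nonneg _) (by positivity) two_ne_zero).1
      (le_of_mul_le_mul_left h2 hm)
  have hsub : closedBall q₀ r ×ˢ closedBall (β q₀) (d / 2) ⊆ ball x₀ d := by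
    rintro ⟨x, y⟩ ⟨hx, hy⟩
    rw [hx₀, ← ball_prod_same]
    exact ⟨closedBall_subset_ball (by linarith) hx, closedBall_subset_ball (by linarith) hy⟩
  -- the curve leaves the ball of radius `r`
  obtain ⟨τ, hτ, hτin, hτr⟩ : ∃ τ ∈ Icc 0 T, (∀ s ∈ Icc 0 τ, z s ∈ ball x₀ d) ∧
      (z τ).1 ∉ ball q₀ r := by
    have h0U : z 0 ∈ ball q₀ r ×ˢ ball (β q₀) (d / 2) := by
      rw [hz0]
      exact ⟨mem_ball_self hr, by simpa [mem_ball, dist_eq_norm] using hε1⟩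
    -- Never leaving the product contradicts the drift. A first exit must happen in position,
    -- because the speed bound keeps the momentum within `d / 2` of `β q₀`.
    rcases forall_mem_or_exists_first_exit hzc (isOpen_ball.prod isOpen_ball) h0U with
      hall | ⟨τ, hτ, hτU, hτin⟩
    · exfalso
      have hin : ∀ s ∈ Icc 0 T, z s ∈ ball x₀ d := fun s hs => hsub
        (prod_mono ball_subset_closedBall ball_subset_closedBall (hall s hs))
      have hdrift := drift_of_slowly_varying (q := fun s => (z s).1) (v := fun s => vel A β (z s))
        (I := fun s => A (z s).1 (vel A β (z s)) (Y (z s).1))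
        (I' := fun s => fderiv ℝ A (z s).1 (Y (z s).1) (vel A β (z s)) (vel A β (z s)) / 2
          + A (z s).1 (vel A β (z s)) (fderiv ℝ Y (z s).1 (vel A β (z s))))
        (ℓ := ℓ) hκ hC hB hε hδB
        (fun s hs => (hasDerivAt_of_hamField (hham s (hIcc s hs) (hin s hs))
          (hinv' _ (hin s hs))).1)
        (fun s hs => by
          obtain ⟨-, -, -, -, hsA, hsβ, hsu, hsY, -, -, -, -, -, h1, h2, h3, -⟩ :=
            hball _ (hin s hs)
          have h4 := hasDerivAt_of_hamField (hham s (hIcc s hs) (hin s hs)) (hinv' _ (hin s hs))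
          exact hasDerivAt_momentum (q := fun s => (z s).1) (hsA.differentiableAt two_ne_zero)
            (hsβ.differentiableAt two_ne_zero) (hsu.differentiableAt two_ne_zero)
            (hsY.differentiableAt one_ne_zero) h4.1 h4.2 h1 h2 (h3 _))
        (fun s hs => hspeed s hs fun s' hs' => hin s' ⟨hs'.1, hs'.2.trans hs.2⟩)
        (fun s hs => by
          obtain ⟨-, -, -, -, -, -, -, -, h1, h2, h3, h4, -⟩ := hball _ (hin s hs)
          exact abs_momentum_deriv_le h1 h2 h3 h4 _)
        (by
          rw [hv0, hz0]
          simp only [map_smul, smul_apply, smul_eq_mul]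
          rfl)
        hδ.le
        (fun s hs => by
          obtain ⟨-, -, -, -, -, -, -, -, -, -, -, -, -, -, -, -, h1⟩ := hball _ (hin s hs)
          exact h1 _)
      have h1 := hall T ⟨hT0.le, le_rfl⟩
      have h2 : ‖(z T).1 - q₀‖ < r := by simpa [dist_eq_norm] using h1.1
      have h3 : ℓ ((z T).1 - q₀) ≤ ‖ℓ‖ * r := by
        calc ℓ ((z T).1 - q₀) ≤ ‖ℓ ((z T).1 - q₀)‖ := le_abs_self _
          _ ≤ ‖ℓ‖ * ‖(z T).1 - q₀‖ := ℓ.le_opNorm _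
          _ ≤ ‖ℓ‖ * r := by gcongr
      simp only [hz0] at hdrift
      linarith
    -- At the exit time the curve is still in the closed product, which lies in the good ball, so
    -- the speed bound applies at `τ` too.
    · have hclos : z τ ∈ closedBall q₀ r ×ˢ closedBall (β q₀) (d / 2) := by
        have h1 : ContinuousWithinAt z (Ico 0 τ) τ :=
          (hz τ (hIcc τ ⟨hτ.1.le, hτ.2⟩)).continuousAt.continuousWithinAt
        have h2 : τ ∈ closure (Ico 0 τ) := by
          rw [closure_Ico hτ.1.ne]
          exact ⟨hτ.1.le, le_rfl⟩
        have h3 : z τ ∈ closure (closedBall q₀ r ×ˢ closedBall (β q₀) (d / 2)) :=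
          h1.mem_closure h2 fun s hs =>
            prod_mono ball_subset_closedBall ball_subset_closedBall (hτin s hs)
        rwa [(isClosed_closedBall.prod isClosed_closedBall).closure_eq] at h3
      have hin : ∀ s ∈ Icc 0 τ, z s ∈ ball x₀ d := by
        intro s hs
        rcases hs.2.eq_or_lt with rfl | hlt
        · exact hsub hclos
        · exact hsub (prod_mono ball_subset_closedBall ball_subset_closedBall
            (hτin s ⟨hs.1, hlt⟩))
      refine ⟨τ, ⟨hτ.1.le, hτ.2⟩, hin, fun hτr => hτU ⟨hτr, ?_⟩⟩
      have hzτ := hin τ ⟨hτ.1.le, le_rfl⟩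
      obtain ⟨-, -, -, -, -, -, -, -, h1, -⟩ := hball _ hzτ
      have h2 := hspeed τ ⟨hτ.1.le, hτ.2⟩ hin
      have h3 := hβr (z τ).1 (ball_subset_ball hrr'.le hτr)
      rw [mem_ball, dist_eq_norm, ← apply_vel (hinv _ hzτ)]
      calc ‖A (z τ).1 (vel A β (z τ)) + β (z τ).1 - β q₀‖
          ≤ ‖A (z τ).1 (vel A β (z τ))‖ + ‖β (z τ).1 - β q₀‖ := by
            rw [add_sub_assoc]; exact norm_add_le _ _
        _ ≤ a₁ * (B * ε) + ‖β (z τ).1 - β q₀‖ := by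
            gcongr
            exact ((A (z τ).1).le_opNorm _).trans (by gcongr)
        _ < d / 2 := by linarith
  -- a slightly larger interval of existence
  have hnear : ∀ t ∈ Icc 0 T, z t ∈ ball x₀ d → ∃ η > 0, η < 1 ∧
      ∀ s ∈ Ioo (t - η) (t + η), z s ∈ ball x₀ d := by
    intro t ht htd
    obtain ⟨η, hη, h⟩ := Metric.eventually_nhds_iff_ball.1
      ((hz t (hIcc t ht)).continuousAt.eventually (isOpen_ball.mem_nhds htd))
    refine ⟨min η (1 / 2), by positivity, (min_le_right _ _).trans_lt (by norm_num),
      fun s hs => h s ?_⟩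
    rw [Real.ball_eq_Ioo]
    exact ⟨by linarith [hs.1, min_le_left η (1 / 2)], by linarith [hs.2, min_le_left η (1 / 2)]⟩
  obtain ⟨η₁, hη₁, hη₁', h1⟩ := hnear 0 ⟨le_rfl, hT0.le⟩ (hτin 0 ⟨le_rfl, hτ.1⟩)
  obtain ⟨η₂, hη₂, hη₂', h2⟩ := hnear τ hτ (hτin τ ⟨hτ.1, le_rfl⟩)
  have hinb : ∀ t ∈ Ioo (-η₁) (τ + η₂), z t ∈ ball x₀ d := by
    intro t ht
    rcases lt_or_ge t 0 with h | h
    · exact h1 t ⟨by linarith [ht.1], by linarith⟩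
    rcases le_or_gt t τ with h' | h'
    · exact hτin t ⟨h, h'⟩
    · exact h2 t ⟨by linarith, ht.2⟩
  have hIoo : ∀ t ∈ Ioo (-η₁) (τ + η₂), t ∈ Ioo (-(T + 1)) (T + 1) := fun t ht =>
    ⟨by linarith [ht.1], by linarith [ht.2, hτ.2]⟩
  have hsol := solvesEulerLagrange_of_hamField (A := A) (β := β) (u := u) (z := z)
    (fun t ht => hham t (hIoo t ht) (hinb t ht))
    (fun t ht => by
      obtain ⟨-, -, -, -, h, -⟩ := hball _ (hinb t ht)
      exact h)
    (fun t ht => by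
      obtain ⟨-, -, -, -, -, h, -⟩ := hball _ (hinb t ht)
      exact h)
    (fun t ht => by
      obtain ⟨-, -, -, -, -, -, h, -⟩ := hball _ (hinb t ht)
      exact h)
    (fun t ht => by
      obtain ⟨-, -, -, h, -⟩ := hball _ (hinb t ht)
      exact h)
    (fun t ht => hinv' _ (hinb t ht))
  have h0 : (0 : ℝ) ∈ Ioo (-η₁) (τ + η₂) := ⟨by linarith, by linarith [hτ.1]⟩
  refine ⟨fun s => (z s).1, -η₁, τ + η₂, h0.1, h0.2, by simp [hz0], ?_, hsol.2,
    fun t ht => (hball _ (hinb t ht)).2.1, hsol.1, τ, ⟨hτ.1, by linarith⟩, hτr⟩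
  rw [← hv0]
  exact (hasDerivAt_of_hamField (hham 0 (hIoo 0 h0) (hinb 0 h0)) (hinv' _ (hinb 0 h0))).1

end

/-! ### Invariance of the Euler–Lagrange equations -/

section

theorem fderiv_fderiv_apply_comm {E G : Type*} [NormedAddCommGroup E] [NormedSpace ℝ E]
    [NormedAddCommGroup G] [NormedSpace ℝ G] {f : E → G} {x : E} (hf : ContDiffAt ℝ 2 f x)
    (v w : E) : fderiv ℝ (fderiv ℝ f) x v w = fderiv ℝ (fderiv ℝ f) x w v :=
  hf.isSymmSndFDerivAt (by simp) v w

/-- The Euler–Lagrange equations are invariant under changes of coordinates. -/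
theorem eulerLagrange_change_coordinates {E : Type*} [NormedAddCommGroup E] [NormedSpace ℝ E]
    {L₁ L₂ : E → E → ℝ} {q₁ q₂ : ℝ → E} {ψ : E → E} {t : ℝ}
    (hψ : ContDiffAt ℝ 2 ψ (q₂ t))
    (hL : ∀ᶠ y in 𝓝 (q₂ t), ∀ w, L₂ y w = L₁ (ψ y) (fderiv ℝ ψ y w))
    (hq : ∀ᶠ s in 𝓝 t, q₁ s = ψ (q₂ s)) (hq₂ : ∀ᶠ s in 𝓝 t, DifferentiableAt ℝ q₂ s)
    (hL₁ : ∀ᶠ s in 𝓝 t, DifferentiableAt ℝ (Function.uncurry L₁) (q₁ s, deriv q₁ s))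
    (h : HasDerivAt (fun s => fderiv ℝ (L₁ (q₁ s)) (deriv q₁ s))
      (fderiv ℝ (fun y => L₁ y (deriv q₁ t)) (q₁ t)) t) :
    HasDerivAt (fun s => fderiv ℝ (L₂ (q₂ s)) (deriv q₂ s))
      (fderiv ℝ (fun y => L₂ y (deriv q₂ t)) (q₂ t)) t := by
  have hcont : ContinuousAt q₂ t := hq₂.self_of_nhds.continuousAt
  have hψ1 : ∀ᶠ y in 𝓝 (q₂ t), DifferentiableAt ℝ ψ y :=
    (hψ.eventually (by simp)).mono fun y hy => hy.differentiableAt two_ne_zero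
  have hdq : ∀ᶠ s in 𝓝 t, deriv q₁ s = fderiv ℝ ψ (q₂ s) (deriv q₂ s) := by
    filter_upwards [hq.eventually_nhds, hq₂, hcont.eventually hψ1] with s h1 h2 h3
    exact ((h3.hasFDerivAt.comp_hasDerivAt s h2.hasDerivAt).congr_of_eventuallyEq h1).deriv
  -- the momenta
  have hp : ∀ᶠ s in 𝓝 t, fderiv ℝ (L₂ (q₂ s)) (deriv q₂ s) =
      (fderiv ℝ (L₁ (q₁ s)) (deriv q₁ s)).comp (fderiv ℝ ψ (q₂ s)) := by
    filter_upwards [hq, hdq, hL₁, hcont.eventually hL] with s h1 h2 h3 h4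
    have h5 : L₂ (q₂ s) = fun w => L₁ (q₁ s) (fderiv ℝ ψ (q₂ s) w) := by
      ext w; rw [h4 w, h1]
    have h6 : DifferentiableAt ℝ (L₁ (q₁ s)) (fderiv ℝ ψ (q₂ s) (deriv q₂ s)) := by
      rw [← h2]
      exact h3.comp (deriv q₁ s) (f := fun w => (q₁ s, w))
        ((differentiableAt_const _).prodMk differentiableAt_id)
    rw [h5, h2]
    exact (h6.hasFDerivAt.comp (deriv q₂ s) (fderiv ℝ ψ (q₂ s)).hasFDerivAt).fderiv
  have hψ2 : DifferentiableAt ℝ (fderiv ℝ ψ) (q₂ t) :=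
    (hψ.fderiv_right (m := 1) (by norm_num)).differentiableAt one_ne_zero
  have hd2 := hψ2.hasFDerivAt.comp_hasDerivAt t hq₂.self_of_nhds.hasDerivAt
  refine ((h.clm_comp hd2).congr_of_eventuallyEq hp).congr_deriv ?_
  -- the forces
  set w := deriv q₂ t
  have hw : deriv q₁ t = fderiv ℝ ψ (q₂ t) w := hdq.self_of_nhds
  have hqt := hq.self_of_nhds
  have hD := hL₁.self_of_nhds.hasFDerivAt
  have hpos : fderiv ℝ (fun y => L₁ y (deriv q₁ t)) (q₁ t) =
      (fderiv ℝ (Function.uncurry L₁) (q₁ t, deriv q₁ t)).comp (.inl ℝ E E) :=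
    (hD.comp (q₁ t) (f := fun y => (y, deriv q₁ t)) (hasFDerivAt_prodMk_left _ _)).fderiv
  have hvel : fderiv ℝ (L₁ (q₁ t)) (deriv q₁ t) =
      (fderiv ℝ (Function.uncurry L₁) (q₁ t, deriv q₁ t)).comp (.inr ℝ E E) :=
    (hD.comp (deriv q₁ t) (f := fun y => (q₁ t, y)) (hasFDerivAt_prodMk_right _ _)).fderiv
  have hin : HasFDerivAt (fun y => (ψ y, fderiv ℝ ψ y w))
      ((fderiv ℝ ψ (q₂ t)).prod ((fderiv ℝ (fderiv ℝ ψ) (q₂ t)).flip w)) (q₂ t) := by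
    refine hψ1.self_of_nhds.hasFDerivAt.prodMk ?_
    refine (hψ2.hasFDerivAt.clm_apply (hasFDerivAt_const w _)).congr_fderiv ?_
    ext; simp
  rw [hqt, hw] at hD
  have hD' := hD.comp (q₂ t) hin
  have hR : HasFDerivAt (fun y => L₂ y w) _ (q₂ t) :=
    hD'.congr_of_eventuallyEq (hL.mono fun y hy => hy w)
  rw [hR.fderiv, hpos, hvel, hqt, hw]
  ext v
  simp only [add_apply, ContinuousLinearMap.comp_apply, ContinuousLinearMap.inl_apply,
    ContinuousLinearMap.inr_apply, ContinuousLinearMap.prod_apply, Function.comp_apply,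
    ContinuousLinearMap.flip_apply]
  -- Differentiating the momentum along the curve produces `D²ψ(w, v)`, differentiating the
  -- Lagrangian in position `D²ψ(v, w)`; symmetry identifies them.
  rw [← map_add, fderiv_fderiv_apply_comm hψ v w]
  simp

/-! ### Vector fields tangent to the fibres of a submersion -/

section Submersion

variable {E G : Type*} [NormedAddCommGroup E] [NormedSpace ℝ E] [FiniteDimensional ℝ E]
  [NormedAddCommGroup G] [NormedSpace ℝ G] [FiniteDimensional ℝ G]

/-- Near a point where `f` is a submersion with fibres of positive dimension there is a nonvanishing
vector field tangent to the fibres. -/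
theorem exists_vectorField_mem_ker_fderiv {f : E → G} {q₀ : E} {n : WithTop ℕ∞}
    (hf : ContDiffAt ℝ (n + 1) f q₀) (hsurj : Function.Surjective (fderiv ℝ f q₀))
    (hdim : Module.finrank ℝ G < Module.finrank ℝ E) :
    ∃ Y : E → E, ContDiffAt ℝ n Y q₀ ∧ Y q₀ ≠ 0 ∧ ∀ᶠ q in 𝓝 q₀, fderiv ℝ f q (Y q) = 0 := by
  have : CompleteSpace G := FiniteDimensional.complete ℝ G
  have : CompleteSpace E := FiniteDimensional.complete ℝ E
  have hf' : ContDiffAt ℝ n (fderiv ℝ f) q₀ := hf.fderiv_right le_rfl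
  obtain ⟨w, hw, hw0⟩ : ∃ w, fderiv ℝ f q₀ w = 0 ∧ w ≠ 0 := by
    have := LinearMap.ker_ne_bot_of_finrank_lt (f := (fderiv ℝ f q₀).toLinearMap) hdim
    obtain ⟨w, hw, hw0⟩ := Submodule.exists_mem_ne_zero_of_ne_bot this
    exact ⟨w, hw, hw0⟩
  obtain ⟨R, hR⟩ := (fderiv ℝ f q₀).toLinearMap.exists_rightInverse_of_surjective
    (LinearMap.range_eq_top.2 hsurj)
  let R' : G →L[ℝ] E := LinearMap.toContinuousLinearMap R
  have hR' : (fderiv ℝ f q₀).comp R' = (ContinuousLinearEquiv.refl ℝ G : G →L[ℝ] G) := by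
    ext y
    exact LinearMap.congr_fun hR y
  have hcomp : ContDiffAt ℝ n (fun q => (fderiv ℝ f q).comp R') q₀ :=
    hf'.clm_comp contDiffAt_const
  have hinv : ContDiffAt ℝ n (fun q => ((fderiv ℝ f q).comp R').inverse) q₀ := by
    refine ContDiffAt.comp (g := ContinuousLinearMap.inverse) q₀ ?_ hcomp
    rw [hR']
    exact contDiffAt_map_inverse _
  have hev : ∀ᶠ q in 𝓝 q₀, ((fderiv ℝ f q).comp R').IsInvertible := by
    have h1 : ContinuousAt (fun q => (fderiv ℝ f q).comp R') q₀ := hcomp.continuousAt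
    refine h1.eventually ?_
    beta_reduce
    rw [hR']
    exact ContinuousLinearEquiv.nhds (ContinuousLinearEquiv.refl ℝ G)
  -- Project `w` to the kernel of `Df(q)` along the range of `R'`. As `Df(q) ∘ R'` is the identity
  -- at `q₀`, it stays invertible nearby, and the projection fixes `w` at `q₀`.
  refine ⟨fun q => w - R' (((fderiv ℝ f q).comp R').inverse (fderiv ℝ f q w)), ?_, ?_, ?_⟩
  · exact contDiffAt_const.sub
      (R'.contDiff.contDiffAt.comp q₀ (hinv.clm_apply (hf'.clm_apply contDiffAt_const)))
  · simpa [hw] using hw0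
  · filter_upwards [hev] with q hq
    have := hq.self_apply_inverse (fderiv ℝ f q w)
    rw [ContinuousLinearMap.comp_apply] at this
    rw [map_sub, this, sub_self]

omit [FiniteDimensional ℝ E] [FiniteDimensional ℝ G] in
/-- A pulled back potential does no work, and a pulled back magnetic field exerts no force, along a
vector field tangent to the fibres. -/
theorem fderiv_pullback_of_mem_ker {f : E → G} {θ : G → G →L[ℝ] ℝ} {Y : E → E} {q : E}
    (hf : ContDiffAt ℝ 2 f q) (hθ : DifferentiableAt ℝ θ (f q)) (hY : DifferentiableAt ℝ Y q)
    (hker : ∀ᶠ y in 𝓝 q, fderiv ℝ f y (Y y) = 0) (v : E) :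
    fderiv ℝ (fun y => (θ (f y)).comp (fderiv ℝ f y)) q (Y q) v +
      (θ (f q)).comp (fderiv ℝ f q) (fderiv ℝ Y q v) = 0 := by
  have hf1 := (hf.differentiableAt two_ne_zero).hasFDerivAt
  have hf2 := ((hf.fderiv_right (m := 1) (by norm_num)).differentiableAt one_ne_zero).hasFDerivAt
  have h1 := (hf2.clm_apply hY.hasFDerivAt).unique
    ((hasFDerivAt_const (0 : G) q).congr_of_eventuallyEq hker)
  have h2 := congrArg (fun φ : E →L[ℝ] G => φ v) h1
  have h3 := (hθ.hasFDerivAt.comp q hf1).clm_comp hf2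
  have h4 : HasFDerivAt (fun y => (θ (f y)).comp (fderiv ℝ f y)) _ q := h3
  rw [h4.fderiv]
  have h5 := hker.self_of_nhds
  simp only [add_apply, ContinuousLinearMap.comp_apply, ContinuousLinearMap.flip_apply,
    zero_apply] at h2
  simp only [add_apply, ContinuousLinearMap.comp_apply, ContinuousLinearMap.compL_apply,
    Function.comp_apply, h5, map_zero, add_zero]
  -- The term with `Dθ` contains `Df(Y) = 0`. After the symmetry of `D²f`, what remains is `θ`
  -- applied to the derivative of `Df(Y) = 0` along `v`.
  rw [← map_add, fderiv_fderiv_apply_comm hf, add_comm, h2, map_zero]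

end Submersion

end

/-! ### Metric, form and Lagrangian in charts -/

section

theorem natCast_le_infty (m : ℕ) : (m : WithTop ℕ∞) ≤ ∞ := by
  exact_mod_cast (le_top : (m : ℕ∞) ≤ ⊤)

variable {n : ℕ} {N : Type*} [TopologicalSpace N] [ChartedSpace (EuclideanSpace ℝ (Fin n)) N]

/-- Stated in the tangent bundle, since the two derivatives take values in fibres over points that
are only propositionally equal. -/
theorem tangentMap_eq_of_eventuallyEq {H M E' : Type*} [NormedAddCommGroup E'] [NormedSpace ℝ E']
    [TopologicalSpace H] {I : ModelWithCorners ℝ E' H} [TopologicalSpace M] [ChartedSpace H M]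
    {f g : M → N} {x : M} (h : f =ᶠ[𝓝 x] g) (w : TangentSpace I x) :
    tangentMap I (𝓡 n) f ⟨x, w⟩ = tangentMap I (𝓡 n) g ⟨x, w⟩ := by
  have h1 := h.mfderiv_eq (I := I) (I' := 𝓡 n)
  have h2 : (⟨f x, mfderiv I (𝓡 n) f x w⟩ : TangentBundle (𝓡 n) N) =
      ⟨g x, mfderiv I (𝓡 n) f x w⟩ := by
    rw [h.self_of_nhds]
  simp only [tangentMap]
  rw [h2, h1]
  rfl

variable [IsManifold (𝓡 n) ∞ N]

theorem contMDiffAt_chart_symm (p : N) {q : EuclideanSpace ℝ (Fin n)}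
    (hq : q ∈ (extChartAt (𝓡 n) p).target) :
    ContMDiffAt (𝓡 n) (𝓡 n) ∞ (extChartAt (𝓡 n) p).symm q :=
  (contMDiffOn_extChartAt_symm p).contMDiffAt ((isOpen_extChartAt_target p).mem_nhds hq)

theorem mdifferentiableAt_chart_symm (p : N) {q : EuclideanSpace ℝ (Fin n)}
    (hq : q ∈ (extChartAt (𝓡 n) p).target) :
    MDifferentiableAt (𝓡 n) (𝓡 n) (extChartAt (𝓡 n) p).symm q :=
  (contMDiffAt_chart_symm p hq).mdifferentiableAt (by simp)

theorem isInvertible_mfderiv_chart_symm (p : N) {q : EuclideanSpace ℝ (Fin n)}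
    (hq : q ∈ (extChartAt (𝓡 n) p).target) :
    (mfderiv (𝓡 n) (𝓡 n) (extChartAt (𝓡 n) p).symm q).IsInvertible := by
  have := isInvertible_mfderivWithin_extChartAt_symm (I := 𝓡 n) hq
  simpa using this

/-- The expression of the metric in the chart at `p`. -/
def chartMetric (ρ : Metric n N) (p : N) (q : EuclideanSpace ℝ (Fin n)) :
    EuclideanSpace ℝ (Fin n) →L[ℝ] EuclideanSpace ℝ (Fin n) →L[ℝ] ℝ :=
  let D : EuclideanSpace ℝ (Fin n) →L[ℝ] EuclideanSpace ℝ (Fin n) :=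
    mfderiv (𝓡 n) (𝓡 n) (extChartAt (𝓡 n) p).symm q
  let B : EuclideanSpace ℝ (Fin n) →L[ℝ] EuclideanSpace ℝ (Fin n) →L[ℝ] ℝ :=
    ρ.inner ((extChartAt (𝓡 n) p).symm q)
  B.bilinearComp D D

theorem contMDiffOn_mfderiv_chart_symm (p : N) (w : EuclideanSpace ℝ (Fin n)) :
    ContMDiffOn (𝓡 n) (𝓡 n).tangent 2
      (fun q => (⟨(extChartAt (𝓡 n) p).symm q,
        mfderiv (𝓡 n) (𝓡 n) (extChartAt (𝓡 n) p).symm q w⟩ : TangentBundle (𝓡 n) N))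
      (extChartAt (𝓡 n) p).target := by
  have hopen := isOpen_extChartAt_target (I := 𝓡 n) p
  have h1 := (contMDiffOn_extChartAt_symm (I := 𝓡 n) (n := ∞) p).contMDiffOn_tangentMapWithin
    (m := 2) (by exact_mod_cast natCast_le_infty 3) hopen.uniqueMDiffOn
  have h2 : ContMDiff (𝓡 n) (𝓡 n).tangent 2
      (fun q => (⟨q, w⟩ : TangentBundle (𝓡 n) (EuclideanSpace ℝ (Fin n)))) := fun q =>
    contMDiffAt_vectorSpace_iff_contDiffAt.2 contDiffAt_const
  have h3 := h1.comp h2.contMDiffOn (s := (extChartAt (𝓡 n) p).target) (fun q hq => hq)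
  refine ContMDiffOn.congr h3 fun q hq => ?_
  simp only [Function.comp_apply, tangentMapWithin]
  rw [mfderivWithin_of_isOpen hopen hq]

/-- In finite dimension it suffices to test on fixed `v` and `w`; there the metric is evaluated on
the images of constant fields under the tangent map of the inverse chart. -/
theorem contDiffOn_chartMetric (ρ : Metric n N) (p : N) :
    ContDiffOn ℝ 2 (chartMetric ρ p) (extChartAt (𝓡 n) p).target := by
  rw [contDiffOn_clm_apply]
  intro v
  rw [contDiffOn_clm_apply]
  intro w
  rw [← contMDiffOn_iff_contDiffOn]
  intro q hq
  have h := ContMDiffWithinAt.clm_bundle_apply₂ (F₁ := EuclideanSpace ℝ (Fin n))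
    (F₂ := EuclideanSpace ℝ (Fin n)) (F₃ := ℝ) (E₃ := Bundle.Trivial N ℝ)
    (ρ.contMDiff.contMDiffAt.comp_contMDiffWithinAt q
      ((contMDiffAt_chart_symm p hq).of_le (natCast_le_infty 2)).contMDiffWithinAt)
    (contMDiffOn_mfderiv_chart_symm p v q hq) (contMDiffOn_mfderiv_chart_symm p w q hq)
  simp only [Bundle.contMDiffWithinAt_totalSpace] at h
  exact h.2

theorem chartMetric_symm (ρ : Metric n N) (p : N) (q v w : EuclideanSpace ℝ (Fin n)) :
    chartMetric ρ p q v w = chartMetric ρ p q w v :=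
  ρ.symm _ _ _

theorem chartMetric_pos (ρ : Metric n N) (p : N) {q : EuclideanSpace ℝ (Fin n)}
    (hq : q ∈ (extChartAt (𝓡 n) p).target) (v : EuclideanSpace ℝ (Fin n)) (hv : v ≠ 0) :
    0 < chartMetric ρ p q v v := by
  have hne : mfderiv (𝓡 n) (𝓡 n) (extChartAt (𝓡 n) p).symm q v ≠ 0 := fun h => hv <|
    (isInvertible_mfderiv_chart_symm p hq).injective (h.trans (map_zero _).symm)
  exact ρ.pos _ _ hne

/-- A form of degree one on `ℝ^k` as a field of linear functionals. -/
def toCovector {k : ℕ} (θ : EuclForm k 1) (y : EuclideanSpace ℝ (Fin k)) :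
    EuclideanSpace ℝ (Fin k) →L[ℝ] ℝ :=
  (ContinuousAlternatingMap.ofSubsingletonLIE (0 : Fin 1)).symm (θ y)

theorem toCovector_apply {k : ℕ} (θ : EuclForm k 1) (y w : EuclideanSpace ℝ (Fin k)) :
    toCovector θ y w = θ y (fun _ => w) := rfl

theorem contDiff_toCovector {k : ℕ} {θ : EuclForm k 1} {m : WithTop ℕ∞} (hθ : ContDiff ℝ m θ) :
    ContDiff ℝ m (toCovector θ) :=
  (ContinuousAlternatingMap.ofSubsingletonLIE (𝕜 := ℝ) (E := EuclideanSpace ℝ (Fin k)) (F := ℝ)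
    (0 : Fin 1)).symm.contDiff.comp hθ

variable {k : ℕ} {F : N → EuclideanSpace ℝ (Fin k)}

theorem fderiv_comp_chart_symm (p : N) {q : EuclideanSpace ℝ (Fin n)}
    (hq : q ∈ (extChartAt (𝓡 n) p).target)
    (hF : MDifferentiableAt (𝓡 n) (𝓡 k) F ((extChartAt (𝓡 n) p).symm q)) :
    fderiv ℝ (F ∘ (extChartAt (𝓡 n) p).symm) q =
      (mfderiv (𝓡 n) (𝓡 k) F ((extChartAt (𝓡 n) p).symm q)).comp
        (mfderiv (𝓡 n) (𝓡 n) (extChartAt (𝓡 n) p).symm q) := by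
  rw [← mfderiv_eq_fderiv]
  exact mfderiv_comp q hF (mdifferentiableAt_chart_symm p hq)

theorem contDiffAt_comp_chart_symm {m : ℕ} (hF : ContMDiff (𝓡 n) (𝓡 k) m F) (p : N)
    {q : EuclideanSpace ℝ (Fin n)} (hq : q ∈ (extChartAt (𝓡 n) p).target) :
    ContDiffAt ℝ m (F ∘ (extChartAt (𝓡 n) p).symm) q := by
  rw [← contMDiffAt_iff_contDiffAt]
  exact hF.contMDiffAt.comp q
    ((contMDiffAt_chart_symm p hq).of_le (natCast_le_infty m))

/-- The expression of the Lagrangian in a chart. -/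
theorem lagrangianInChart_eq_lag (ρ : Metric n N) (θ : EuclForm k 1)
    (g : EuclideanSpace ℝ (Fin k) → ℝ) (hF : ContMDiff (𝓡 n) (𝓡 k) 3 F) (p : N)
    {q : EuclideanSpace ℝ (Fin n)} (hq : q ∈ (extChartAt (𝓡 n) p).target)
    (w : EuclideanSpace ℝ (Fin n)) :
    lagrangianInChart (lagrangian ρ (pullback F θ) (g ∘ F)) p q w =
      lag (chartMetric ρ p) (fun y => (toCovector θ ((F ∘ (extChartAt (𝓡 n) p).symm) y)).comp
        (fderiv ℝ (F ∘ (extChartAt (𝓡 n) p).symm) y)) (g ∘ F ∘ (extChartAt (𝓡 n) p).symm) q w := by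
  simp only [lag, ContinuousLinearMap.comp_apply, toCovector_apply]
  rw [fderiv_comp_chart_symm p hq ((hF _).mdifferentiableAt (by norm_num))]
  rfl

/-- Passing from one chart to another. -/
theorem lagrangianInChart_change (L : TangentBundle (𝓡 n) N → ℝ) (p x₀ : N)
    {y : EuclideanSpace ℝ (Fin n)} (hy : y ∈ (extChartAt (𝓡 n) x₀).target)
    (hyp : (extChartAt (𝓡 n) x₀).symm y ∈ (extChartAt (𝓡 n) p).source)
    (w : EuclideanSpace ℝ (Fin n)) :
    lagrangianInChart L x₀ y w =
      lagrangianInChart L p ((extChartAt (𝓡 n) p ∘ (extChartAt (𝓡 n) x₀).symm) y)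
        (fderiv ℝ (extChartAt (𝓡 n) p ∘ (extChartAt (𝓡 n) x₀).symm) y w) := by
  have hcont := (contMDiffAt_chart_symm x₀ hy).continuousAt
  have hev : (extChartAt (𝓡 n) x₀).symm =ᶠ[𝓝 y]
      (extChartAt (𝓡 n) p).symm ∘ (extChartAt (𝓡 n) p ∘ (extChartAt (𝓡 n) x₀).symm) := by
    filter_upwards [hcont.eventually ((isOpen_extChartAt_source (I := 𝓡 n) p).mem_nhds hyp)] with z hz
    exact ((extChartAt (𝓡 n) p).left_inv hz).symm
  have hψ : MDifferentiableAt (𝓡 n) (𝓡 n) (extChartAt (𝓡 n) p ∘ (extChartAt (𝓡 n) x₀).symm) y :=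
    (mdifferentiableAt_extChartAt (I := 𝓡 n) (by simpa using hyp)).comp y
      (mdifferentiableAt_chart_symm x₀ hy)
  have h1 := tangentMap_eq_of_eventuallyEq (n := n) (N := N) (I := 𝓡 n) hev w
  rw [tangentMap_comp_at (I := 𝓡 n) (I' := 𝓡 n) (I'' := 𝓡 n) (g := (extChartAt (𝓡 n) p).symm)
    (f := extChartAt (𝓡 n) p ∘ (extChartAt (𝓡 n) x₀).symm)
    (⟨y, w⟩ : TangentBundle (𝓡 n) (EuclideanSpace ℝ (Fin n)))
    (mdifferentiableAt_chart_symm p ((extChartAt (𝓡 n) p).map_source hyp)) hψ] at h1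
  have h2 : lagrangianInChart L x₀ y w =
      L (tangentMap (𝓡 n) (𝓡 n) (M' := N) (extChartAt (𝓡 n) x₀).symm ⟨y, w⟩) := rfl
  rw [h2, h1, ← mfderiv_eq_fderiv]
  rfl

end

/-! ### Equilibria, solutions and instability on the manifold -/

section

variable {n : ℕ} {N : Type*} [TopologicalSpace N] [ChartedSpace (EuclideanSpace ℝ (Fin n)) N]
  [IsManifold (𝓡 n) ∞ N] {k : ℕ} {F : N → EuclideanSpace ℝ (Fin k)}

theorem lagrangian_zero (ρ : Metric n N) (μ : DiffForm n N 1) (U : N → ℝ) (x : N) :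
    lagrangian ρ μ U ⟨x, 0⟩ = -U x := by
  have h : μ x (fun _ => 0) = 0 := (μ x).map_coord_zero (0 : Fin 1) rfl
  simp [lagrangian, h]

/-- At zero velocity the Lagrangian is `-U`, maximal at `p` in every chart, so the force vanishes,
while the momentum of a constant curve is constant. Without differentiability `fderiv` is zero by
default, so Fermat's lemma still applies. -/
theorem isEquilibrium_of_isMin (ρ : Metric n N) (μ : DiffForm n N 1) (U : N → ℝ) (p : N)
    (hU : ∀ x, U p ≤ U x) : IsEquilibrium (lagrangian ρ μ U) p := by
  refine fun a b => ⟨contMDiffOn_const, fun t _ x₀ hx₀ => ?_⟩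
  have h0 : ∀ y, lagrangianInChart (lagrangian ρ μ U) x₀ y 0 =
      -U ((extChartAt (𝓡 n) x₀).symm y) := by
    intro y
    rw [← lagrangian_zero ρ μ U]
    exact congrArg (fun v => lagrangian ρ μ U ⟨(extChartAt (𝓡 n) x₀).symm y, v⟩)
      (map_zero (mfderiv (𝓡 n) (𝓡 n) (extChartAt (𝓡 n) x₀).symm y))
  have hmax : IsLocalMax (fun y => lagrangianInChart (lagrangian ρ μ U) x₀ y 0)
      (extChartAt (𝓡 n) x₀ p) := by
    refine Eventually.of_forall fun y => ?_
    simp only [h0, (extChartAt (𝓡 n) x₀).left_inv hx₀]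
    exact neg_le_neg (hU _)
  simp only [deriv_const]
  rw [hmax.fderiv_eq_zero]
  exact hasDerivAt_const _ _

section Chart

variable (θ : EuclForm k 1) (F)

/-- The expression in the chart at `p` of the pullback of a form of degree one. -/
def chartPullback (p : N) (y : EuclideanSpace ℝ (Fin n)) : EuclideanSpace ℝ (Fin n) →L[ℝ] ℝ :=
  (toCovector θ ((F ∘ (extChartAt (𝓡 n) p).symm) y)).comp
    (fderiv ℝ (F ∘ (extChartAt (𝓡 n) p).symm) y)

end Chart

theorem contDiffAt_chartPullback {θ : EuclForm k 1} (hθ : ContDiff ℝ 2 θ)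
    (hF : ContMDiff (𝓡 n) (𝓡 k) 3 F) (p : N) {q : EuclideanSpace ℝ (Fin n)}
    (hq : q ∈ (extChartAt (𝓡 n) p).target) : ContDiffAt ℝ 2 (chartPullback F θ p) q := by
  have hf : ContDiffAt ℝ 3 (F ∘ (extChartAt (𝓡 n) p).symm) q := contDiffAt_comp_chart_symm hF p hq
  exact ((contDiff_toCovector hθ).contDiffAt.comp q (hf.of_le (by norm_num))).clm_comp
    (hf.fderiv_right (by norm_num))

/-- A solution of the Euler–Lagrange equations in one chart is a solution. -/
theorem isSolution_of_solvesEulerLagrange (ρ : Metric n N) {θ : EuclForm k 1}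
    (hθ : ContDiff ℝ 2 θ) {g : EuclideanSpace ℝ (Fin k) → ℝ} (hg : ContDiff ℝ 2 g)
    (hF : ContMDiff (𝓡 n) (𝓡 k) 3 F) (p : N) {q : ℝ → EuclideanSpace ℝ (Fin n)} {a b : ℝ}
    (hq : ContDiffOn ℝ 2 q (Ioo a b)) (hqt : ∀ t ∈ Ioo a b, q t ∈ (extChartAt (𝓡 n) p).target)
    (hsol : SolvesEulerLagrange (chartMetric ρ p) (chartPullback F θ p)
      (g ∘ F ∘ (extChartAt (𝓡 n) p).symm) q a b) :
    IsSolution (lagrangian ρ (pullback F θ) (g ∘ F)) ((extChartAt (𝓡 n) p).symm ∘ q) a b := by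
  have hqd : ∀ t ∈ Ioo a b, DifferentiableAt ℝ q t := fun t ht =>
    (hq.contDiffAt (isOpen_Ioo.mem_nhds ht)).differentiableAt two_ne_zero
  refine ⟨?_, fun t ht x₀ hx₀ => ?_⟩
  · exact ((contMDiffOn_extChartAt_symm p).of_le (natCast_le_infty 2)).comp hq.contMDiffOn hqt
  set e := extChartAt (𝓡 n) p with he
  set e₀ := extChartAt (𝓡 n) x₀ with he₀
  have hxp : e.symm (q t) ∈ e.source := e.map_target (hqt t ht)
  have hγc : ContinuousAt (e.symm ∘ q) t :=
    (contMDiffAt_chart_symm p (hqt t ht)).continuousAt.comp (hqd t ht).continuousAt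
  have hy : e₀ (e.symm (q t)) ∈ e₀.target := e₀.map_source hx₀
  have hinv : e₀.symm (e₀ (e.symm (q t))) = e.symm (q t) := e₀.left_inv hx₀
  have hev : ∀ᶠ y in 𝓝 (e₀ (e.symm (q t))), y ∈ e₀.target ∧ e₀.symm y ∈ e.source := by
    refine ((isOpen_extChartAt_target x₀).mem_nhds hy |> eventually_mem_set.2).and ?_
    refine (contMDiffAt_chart_symm x₀ hy).continuousAt.eventually ?_
    rw [hinv]
    exact (isOpen_extChartAt_source (I := 𝓡 n) p).mem_nhds hxp
  have hψ : ContDiffAt ℝ 2 (e ∘ e₀.symm) (e₀ (e.symm (q t))) := by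
    rw [← contMDiffAt_iff_contDiffAt]
    refine ContMDiffAt.comp (I' := 𝓡 n) _ ?_
      ((contMDiffAt_chart_symm x₀ hy).of_le (natCast_le_infty 2))
    rw [hinv]
    exact contMDiffAt_extChartAt' (by simpa [he] using hxp)
  have hev2 : ∀ᶠ s in 𝓝 t, s ∈ Ioo a b ∧ e.symm (q s) ∈ e₀.source :=
    (eventually_mem_set.2 (isOpen_Ioo.mem_nhds ht)).and
      (hγc.eventually ((isOpen_extChartAt_source (I := 𝓡 n) x₀).mem_nhds hx₀))
  -- The equations are required in every chart around the point; the transition map `ψ` reduces them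
  -- to the chart at `p`.
  refine eulerLagrange_change_coordinates
    (L₁ := lag (chartMetric ρ p) (chartPullback F θ p) (g ∘ F ∘ e.symm))
    (L₂ := lagrangianInChart (lagrangian ρ (pullback F θ) (g ∘ F)) x₀) (q₁ := q)
    (q₂ := fun s => e₀ (e.symm (q s))) (ψ := e ∘ e₀.symm) hψ ?_ ?_ ?_ ?_ (hsol t ht)
  · filter_upwards [hev] with y hy w
    rw [lagrangianInChart_change _ p x₀ hy.1 hy.2 w]
    exact lagrangianInChart_eq_lag ρ θ g hF p (e.map_source hy.2) _
  · filter_upwards [hev2] with s hs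
    simp only [Function.comp_apply]
    rw [e₀.left_inv hs.2, e.right_inv (hqt s hs.1)]
  · filter_upwards [hev2] with s hs
    have h1 : MDifferentiableAt (𝓡 n) (𝓡 n) (e₀ ∘ e.symm) (q s) :=
      MDifferentiableAt.comp (I' := 𝓡 n) _
        (mdifferentiableAt_extChartAt (by simpa [he₀] using hs.2))
        (mdifferentiableAt_chart_symm p (hqt s hs.1))
    exact (mdifferentiableAt_iff_differentiableAt.1 h1).comp s (hqd s hs.1)
  · filter_upwards [hev2] with s hs
    have hs1 := hqt s hs.1
    have hopen := isOpen_extChartAt_target (I := 𝓡 n) p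
    exact (contDiffAt_lag ((contDiffOn_chartMetric ρ p).contDiffAt (hopen.mem_nhds hs1))
      (contDiffAt_chartPullback hθ hF p hs1)
      (hg.contDiffAt.comp (q s) ((contDiffAt_comp_chart_symm hF p hs1).of_le
        (by norm_num))) _).differentiableAt two_ne_zero

theorem phasePoint_chart_symm_comp (p : N) {q : ℝ → EuclideanSpace ℝ (Fin n)} {t : ℝ}
    {w : EuclideanSpace ℝ (Fin n)} (hq : HasDerivAt q w t)
    (hqt : q t ∈ (extChartAt (𝓡 n) p).target) :
    phasePoint ((extChartAt (𝓡 n) p).symm ∘ q) t =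
      ⟨(extChartAt (𝓡 n) p).symm (q t),
        mfderiv (𝓡 n) (𝓡 n) (extChartAt (𝓡 n) p).symm (q t) w⟩ := by
  have h1 : HasMFDerivAt 𝓘(ℝ, ℝ) (𝓡 n) q t (ContinuousLinearMap.toSpanSingleton ℝ w) :=
    hq.hasFDerivAt.hasMFDerivAt
  have h2 := ((mdifferentiableAt_chart_symm p hqt).hasMFDerivAt.comp t h1).mfderiv
  rw [phasePoint, h2]
  congr 1
  exact congrArg (mfderiv (𝓡 n) (𝓡 n) (extChartAt (𝓡 n) p).symm (q t)) (one_smul ℝ w)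

/-- A zero of the potential is unstable if the fibres of `F` have positive dimension. -/
theorem not_isLyapunovStable_lagrangian (hkn : k < n) (ρ : Metric n N) {θ : EuclForm k 1}
    (hθ : ContDiff ℝ 2 θ) {g : EuclideanSpace ℝ (Fin k) → ℝ} (hg : ContDiff ℝ 2 g)
    (hg_nonneg : ∀ y, 0 ≤ g y) (hF : ContMDiff (𝓡 n) (𝓡 k) 3 F) {p : N} (hp : g (F p) = 0)
    (hsurj : Function.Surjective (mfderiv (𝓡 n) (𝓡 k) F p)) :
    ¬ IsLyapunovStable (lagrangian ρ (pullback F θ) (g ∘ F)) p := by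
  set e := extChartAt (𝓡 n) p with he
  set f := F ∘ e.symm with hf
  set q₀ := e p with hq₀
  have hq₀t : q₀ ∈ e.target := mem_extChartAt_target p
  have hopen : IsOpen e.target := isOpen_extChartAt_target p
  have hinv : e.symm q₀ = p := extChartAt_to_inv p
  have hf3 : ∀ q ∈ e.target, ContDiffAt ℝ 3 f q := fun q hq => contDiffAt_comp_chart_symm hF p hq
  have hfsurj : Function.Surjective (fderiv ℝ f q₀) := by
    rw [fderiv_comp_chart_symm p hq₀t ((hF _).mdifferentiableAt (by norm_num))]
    have h : ∀ x, x = p → Function.Surjective (mfderiv (𝓡 n) (𝓡 k) F x) := by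
      rintro x rfl; exact hsurj
    exact (h _ hinv).comp (isInvertible_mfderiv_chart_symm p hq₀t).surjective
  obtain ⟨Y, hY, hY0, hYker⟩ := exists_vectorField_mem_ker_fderiv (n := 2)
    (by simpa [two_add_one_eq_three] using hf3 q₀ hq₀t) hfsurj (by simpa using hkn)
  have htarget : ∀ᶠ q in 𝓝 q₀, q ∈ e.target := hopen.mem_nhds hq₀t
  obtain ⟨r, hr, hsols⟩ := exists_solution_leaving_ball (A := chartMetric ρ p)
    (β := chartPullback F θ p) (u := g ∘ f) (q₀ := q₀) (Y := Y) (Ω := e.target)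
    (hopen.mem_nhds hq₀t) ((contDiffOn_chartMetric ρ p).contDiffAt (hopen.mem_nhds hq₀t))
    (contDiffAt_chartPullback hθ hF p hq₀t)
    (hg.contDiffAt.comp q₀ ((hf3 q₀ hq₀t).of_le (by norm_num)))
    (hY.of_le one_le_two) (Eventually.of_forall (chartMetric_symm ρ p))
    (chartMetric_pos ρ p hq₀t) (by simp [hf, hinv, hp])
    (Eventually.of_forall fun q => hg_nonneg _) hY0
    (by
      filter_upwards [hYker] with q hq
      rw [chartPullback, ContinuousLinearMap.comp_apply, hq, map_zero])
    (by
      filter_upwards [hYker, htarget] with q hq hqt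
      rw [fderiv_comp q (hg.differentiable two_ne_zero _)
        ((hf3 q hqt).differentiableAt (by norm_num)), ContinuousLinearMap.comp_apply, hq, map_zero])
    (by
      filter_upwards [hYker.eventually_nhds, htarget,
        (hY.of_le one_le_two).eventually (by simp)] with q hq hqt hYq v
      exact fderiv_pullback_of_mem_ker ((hf3 q hqt).of_le (by norm_num))
        ((contDiff_toCovector hθ).differentiable two_ne_zero _)
        (hYq.differentiableAt one_ne_zero) hq v)
  intro hst
  -- The neighborhood restricts only the position, since it is the position that escapes.
  have hV : {z : TangentBundle (𝓡 n) N | z.1 ∈ e.source ∩ e ⁻¹' ball q₀ r} ∈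
      𝓝 (⟨p, 0⟩ : TangentBundle (𝓡 n) N) := by
    have h1 : ContinuousAt (fun z : TangentBundle (𝓡 n) N => z.1) ⟨p, 0⟩ :=
      (FiberBundle.continuous_proj (EuclideanSpace ℝ (Fin n)) (TangentSpace (𝓡 n))).continuousAt
    refine h1.preimage_mem_nhds (inter_mem (extChartAt_source_mem_nhds p) ?_)
    exact (continuousAt_extChartAt p).preimage_mem_nhds (ball_mem_nhds _ hr)
  obtain ⟨W, hW, hWst⟩ := hst _ hV
  -- The initial conditions lie in one fibre of the tangent bundle and tend to its zero vector as `ε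
  -- → 0`.
  have hWε : ∀ᶠ ε in 𝓝[>] (0 : ℝ), (⟨e.symm q₀, mfderiv (𝓡 n) (𝓡 n) e.symm q₀ (ε • Y q₀)⟩ :
      TangentBundle (𝓡 n) N) ∈ W := by
    have h1 : Continuous fun ε : ℝ => (⟨e.symm q₀, mfderiv (𝓡 n) (𝓡 n) e.symm q₀ (ε • Y q₀)⟩ :
        TangentBundle (𝓡 n) N) := by
      refine (FiberBundle.continuous_totalSpaceMk (EuclideanSpace ℝ (Fin n))
        (TangentSpace (𝓡 n)) (e.symm q₀)).comp ?_
      exact (mfderiv (𝓡 n) (𝓡 n) e.symm q₀).continuous.comp (continuous_id.smul continuous_const)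
    have h2 : (⟨e.symm q₀, mfderiv (𝓡 n) (𝓡 n) e.symm q₀ ((0 : ℝ) • Y q₀)⟩ :
        TangentBundle (𝓡 n) N) = ⟨p, 0⟩ := by
      have h3 : mfderiv (𝓡 n) (𝓡 n) e.symm q₀ ((0 : ℝ) • Y q₀) = 0 := by
        rw [zero_smul]; exact map_zero _
      have h4 : ∀ x, x = p → (⟨x, 0⟩ : TangentBundle (𝓡 n) N) = ⟨p, 0⟩ := by
        rintro x rfl; rfl
      rw [h3, h4 _ hinv]
    exact (h1.tendsto 0).mono_left nhdsWithin_le_nhds (h2 ▸ hW)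
  obtain ⟨ε, ⟨q, a, b, ha, hb, hq0, hq', hqc, hqt, hEL, t, ht, htr⟩, hεW⟩ :=
    (hsols.and hWε).exists
  have h0 : (0 : ℝ) ∈ Ioo a b := ⟨ha, hb⟩
  have hphase : phasePoint (e.symm ∘ q) 0 ∈ W := by
    rw [phasePoint_chart_symm_comp p hq' (hqt 0 h0), hq0]
    exact hεW
  have hmem := hWst _ a b ha hb
    (isSolution_of_solvesEulerLagrange ρ hθ hg hF p hqc hqt hEL) hphase t ht
  refine htr ?_
  have h5 : e ((e.symm ∘ q) t) ∈ ball q₀ r := hmem.2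
  rwa [Function.comp_apply, e.right_inv (hqt t ⟨ha.trans_le ht.1, ht.2⟩)] at h5

end

/-! ### The exterior derivative of the pulled back form -/

section

/-- Every tuple of vectors in `W` lifts through the surjection, so a form killed by the pullback is
zero. -/
theorem compContinuousLinearMap_ne_zero {V W ι : Type*} [AddCommGroup V] [Module ℝ V]
    [TopologicalSpace V] [AddCommGroup W] [Module ℝ W] [TopologicalSpace W] {α : W [⋀^ι]→L[ℝ] ℝ}
    (hα : α ≠ 0) {f : V →L[ℝ] W} (hf : Function.Surjective f) :
    α.compContinuousLinearMap f ≠ 0 := by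
  intro h
  refine hα (ContinuousAlternatingMap.ext fun w => ?_)
  choose v hv using fun i => hf (w i)
  have h1 : α.compContinuousLinearMap f v = 0 := by rw [h]; rfl
  rw [ContinuousAlternatingMap.compContinuousLinearMap_apply] at h1
  have h2 : f ∘ v = w := funext hv
  rwa [h2] at h1

variable {n : ℕ} {N : Type*} [TopologicalSpace N] [ChartedSpace (EuclideanSpace ℝ (Fin n)) N]
  [IsManifold (𝓡 n) ∞ N] {k : ℕ} {F : N → EuclideanSpace ℝ (Fin k)}

/-- The exterior derivative commutes with the pullback under `F`. -/
theorem extDeriv_inChart_pullback {m : ℕ} {θ : EuclForm k m} (hF : ContMDiff (𝓡 n) (𝓡 k) 2 F)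
    (p : N) (hθ : DifferentiableAt ℝ θ (F p)) :
    extDeriv (inChart p (pullback F θ)) (extChartAt (𝓡 n) p p) =
      (extDeriv θ (F p)).compContinuousLinearMap
        (fderiv ℝ (F ∘ (extChartAt (𝓡 n) p).symm) (extChartAt (𝓡 n) p p)) := by
  have hpt : extChartAt (𝓡 n) p p ∈ (extChartAt (𝓡 n) p).target := mem_extChartAt_target p
  have hFp : (F ∘ (extChartAt (𝓡 n) p).symm) (extChartAt (𝓡 n) p p) = F p := by
    simp
  have hev : inChart p (pullback F θ) =ᶠ[𝓝 (extChartAt (𝓡 n) p p)] fun q =>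
      (θ ((F ∘ (extChartAt (𝓡 n) p).symm) q)).compContinuousLinearMap
        (fderiv ℝ (F ∘ (extChartAt (𝓡 n) p).symm) q) := by
    filter_upwards [(isOpen_extChartAt_target p).mem_nhds hpt] with q hq
    rw [fderiv_comp_chart_symm p hq ((hF _).mdifferentiableAt two_ne_zero)]
    rfl
  rw [hev.extDeriv_eq, extDeriv_pullback (r := 2) (hFp ▸ hθ)
    (contDiffAt_comp_chart_symm hF p hpt) (by simp), hFp]

theorem extDer_pullback_ne_zero {m : ℕ} {θ : EuclForm k m} (hF : ContMDiff (𝓡 n) (𝓡 k) 2 F)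
    {p : N} (hθ : DifferentiableAt ℝ θ (F p))
    (hsurj : Function.Surjective (mfderiv (𝓡 n) (𝓡 k) F p)) (hdθ : extDeriv θ (F p) ≠ 0) :
    extDer (n := n) (pullback F θ) p ≠ 0 := by
  have hpt : extChartAt (𝓡 n) p p ∈ (extChartAt (𝓡 n) p).target := mem_extChartAt_target p
  have hinv : (extChartAt (𝓡 n) p).symm (extChartAt (𝓡 n) p p) = p := extChartAt_to_inv p
  have h1 : Function.Surjective
      (fderiv ℝ (F ∘ (extChartAt (𝓡 n) p).symm) (extChartAt (𝓡 n) p p)) := by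
    rw [fderiv_comp_chart_symm p hpt ((hF _).mdifferentiableAt two_ne_zero)]
    have h : ∀ x, x = p → Function.Surjective (mfderiv (𝓡 n) (𝓡 k) F x) := by
      rintro x rfl; exact hsurj
    exact (h _ hinv).comp (isInvertible_mfderiv_chart_symm p hpt).surjective
  rw [extDer, extDeriv_inChart_pullback hF p hθ]
  exact compContinuousLinearMap_ne_zero (compContinuousLinearMap_ne_zero hdθ h1)
    (isInvertible_mfderiv_extChartAt (mem_extChartAt_source p)).surjective

/-- The one-form `y_i dy_j` is smooth and not closed at any point for `i ≠ j`. -/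
theorem exists_smooth_form_extDeriv_ne_zero (hk : 1 < k) :
    ∃ θ : EuclForm k 1, ContDiff ℝ ∞ θ ∧ ∀ y, extDeriv θ y ≠ 0 := by
  let i : Fin k := ⟨0, by omega⟩
  let j : Fin k := ⟨1, hk⟩
  have hij : i ≠ j := by simp [i, j]
  -- The form `y_i dy_j` is linear in `y`, hence smooth and equal to its own derivative.
  let Θ : EuclideanSpace ℝ (Fin k) →L[ℝ] EuclideanSpace ℝ (Fin k) [⋀^Fin 1]→L[ℝ] ℝ :=
    ((ContinuousAlternatingMap.ofSubsingletonLIE (𝕜 := ℝ) (E := EuclideanSpace ℝ (Fin k)) (F := ℝ)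
      (0 : Fin 1)).toContinuousLinearEquiv.toContinuousLinearMap).comp
      ((EuclideanSpace.proj i).smulRight (EuclideanSpace.proj j : _ →L[ℝ] ℝ))
  have hΘ : ∀ y v, Θ y v = y i * v 0 j := fun y v => rfl
  refine ⟨Θ, Θ.contDiff, fun y h => ?_⟩
  have h1 : extDeriv Θ y ![EuclideanSpace.single i 1, EuclideanSpace.single j 1] = 0 := by
    rw [h]; rfl
  -- On `(e_i, e_j)` the alternating sum has two terms: one is `1`, the other vanishes because `i ≠
  -- j`.
  rw [extDeriv, Θ.fderiv, ContinuousAlternatingMap.alternatizeUncurryFin_apply] at h1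
  simp [Fin.sum_univ_two, hΘ, Fin.removeNth, hij.symm] at h1

end

end MechLagrangian

end

theorem corollary3 {n k : ℕ} (hkn : k < n)
    {N : Type*} [TopologicalSpace N] [T2Space N] [SecondCountableTopology N]
    [ChartedSpace (EuclideanSpace ℝ (Fin n)) N] [IsManifold (𝓡 n) ∞ N]
    (ρ : MechLagrangian.Metric n N)
    (g : EuclideanSpace ℝ (Fin k) → ℝ) (hg : ContDiff ℝ 2 g)
    (hg_nonneg : ∀ y, 0 ≤ g y) (hg_zero : ∀ y, g y = 0 ↔ y = 0)
    (F : N → EuclideanSpace ℝ (Fin k)) (hF : ContMDiff (𝓡 n) (𝓡 k) 3 F)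
    (hF_reg : ∀ x, F x = 0 → Function.Surjective (mfderiv (𝓡 n) (𝓡 k) F x))
    (hF_comm : ∀ i j : Fin k, ∀ x : N,
      MechLagrangian.grad ρ (fun z => F z i) x ≠ 0 →
      MechLagrangian.grad ρ (fun z => F z j) x ≠ 0 →
      VectorField.mlieBracket (𝓡 n) (MechLagrangian.normGrad ρ (fun z => F z i))
        (MechLagrangian.normGrad ρ (fun z => F z j)) x = 0)
    (hF_orth : ∀ i j : Fin k, i ≠ j → ∀ x : N,
      ρ.inner x (MechLagrangian.grad ρ (fun z => F z i) x)
        (MechLagrangian.grad ρ (fun z => F z j) x) = 0) :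
    (∀ θ : MechLagrangian.EuclForm k 1, ContDiff ℝ 2 θ →
      (∀ p : N, (g ∘ F) p = 0 →
        MechLagrangian.IsLyapunovUnstableEquilibrium
          (MechLagrangian.lagrangian ρ (MechLagrangian.pullback F θ) (g ∘ F)) p) ∧
      (extDeriv θ 0 ≠ 0 → ∀ p : N, (g ∘ F) p = 0 →
        MechLagrangian.extDer (n := n) (MechLagrangian.pullback F θ) p ≠ 0)) ∧
    (1 < k → ∃ θ : MechLagrangian.EuclForm k 1, ContDiff ℝ ∞ θ ∧
      ∀ p : N, (g ∘ F) p = 0 →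
        MechLagrangian.extDer (n := n) (MechLagrangian.pullback F θ) p ≠ 0) := by
  have hF2 : ContMDiff (𝓡 n) (𝓡 k) 2 F := hF.of_le (by norm_num)
  have hF0 : ∀ p : N, (g ∘ F) p = 0 → F p = 0 := fun p hp => (hg_zero _).1 hp
  refine ⟨fun θ hθ => ⟨fun p hp => ⟨?_, ?_⟩, fun hdθ p hp => ?_⟩, fun hk => ?_⟩
  · refine MechLagrangian.isEquilibrium_of_isMin ρ _ _ p fun x => ?_
    rw [hp]
    exact hg_nonneg _
  · exact MechLagrangian.not_isLyapunovStable_lagrangian hkn ρ hθ hg hg_nonneg hF hp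
      (hF_reg p (hF0 p hp))
  · exact MechLagrangian.extDer_pullback_ne_zero hF2 (hθ.differentiable two_ne_zero _)
      (hF_reg p (hF0 p hp)) (by rwa [hF0 p hp])
  · obtain ⟨θ, hθ, hdθ⟩ := MechLagrangian.exists_smooth_form_extDeriv_ne_zero hk
    exact ⟨θ, hθ, fun p hp => MechLagrangian.extDer_pullback_ne_zero hF2
      (hθ.differentiable (by simp) _) (hF_reg p (hF0 p hp)) (hdθ _)⟩
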